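/- Let $f,g_1,\dots,g_m\in\mathbb{R}[x_1,\dots,x_n]$, let $\mathbf{K}=\{\mathbf{x}\in\mathbb{R}^n: g_j(\mathbf{x})\ge 0,\ j=1,\dots,m\}$, and assume that for some $M>0$ one has $$M-\Vert\mathbf{x}\Vert^2=\sigma_0+\sum_{j=1}^m\sigma_j\,g_j$$ with sums of squares of polynomials $\sigma_0,\dots,\sigma_m\in\mathbb{R}[\mathbf{x}]$ (so that $\mathbf{K}$ is compact). Fix $k\in\{1,\dots,n\}$, and assume that the orthogonal projection of $\mathbf{K}$ onto the $x_k$-axis is an interval $\mathbf{Y}_k=[\underline{x}_k,\overline{x}_k]$ with $\underline{x}_k<\overline{x}_k$, so that $\mathbf{K}_y:=\{\mathbf{x}\in\mathbf{K}:x_k=y\}$ is nonempty for every $y\in\mathbf{Y}_k$. Let $\varphi_k$ be the uniform probability measure on $\mathbf{Y}_k$, let $\beta_\ell=\int_{\mathbf{Y}_k} y^\ell\,d\varphi_k(y)$, and let $J^k(y)=\min\{f(\mathbf{x}):\mathbf{x}\in\mathbf{K}_y\}$ for $y\in\mathbf{Y}_k$. For a real sequence $\mathbf{z}=(z_\alpha)_{\alpha\in\mathbb{N}^n}$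 let $L_\mathbf{z}(q)=\sum_\alpha q_\alpha z_\alpha$ for $q=\sum_\alpha q_\alpha\mathbf{x}^\alpha$; let $\mathbf{M}_i(\mathbf{z})$ and $\mathbf{M}_i(q\,\mathbf{z})$ be the matrices indexed by $\{\alpha\in\mathbb{N}^n:|\alpha|\le i\}$ with entries $z_{\alpha+\beta}$ and $L_\mathbf{z}(q\,\mathbf{x}^{\alpha+\beta})$, respectively. Put $v_j=\lceil \deg(g_j)/2\rceil$ and, for $i\ge\max_j v_j$, define in $[-\infty,+\infty]$ $$\rho_{ik}=\inf_{\mathbf{z}}\{L_\mathbf{z}(f):\ \mathbf{M}_i(\mathbf{z})\succeq0;\ \mathbf{M}_{i-v_j}(g_j\,\mathbf{z})\succeq0,\ 1\le j\le m;\ L_\mathbf{z}(x_k^\ell)=\beta_\ell,\ 0\le\ell\le 2i\},$$ $$\rho^*_{ik}=\sup_{p,(\sigma_j)}\Big\{\int_{\mathbf{Y}_k} p\,d\varphi_k:\ f-p(x_k)=\sigma_0+\sum_{j=1}^m\sigma_j\,g_j\Big\},$$ where the supremum is over univariate real polynomials $p$ of degree at most $2i$ and sums of squares $\sigma_0,\dots,\sigma_m\in\mathbb{R}[\mathbf{x}]$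 with $\deg\sigma_0\le 2i$ and $\deg(\sigma_jg_j)\le 2i$ for $1\le j\le m$. Then $J^k$ is well defined (the minimum is attained) and $\varphi_k$-integrable, and: (a) As $i\to\infty$, $\rho_{ik}\uparrow\int_{\mathbf{Y}_k}J^k\,d\varphi_k$ and $\rho^*_{ik}\uparrow\int_{\mathbf{Y}_k}J^k\,d\varphi_k$ (both sequences are nondecreasing in $i\ge\max_jv_j$). (b) Let $i_0\ge\max_jv_j$, let $\varepsilon_i\to0$ (for example $\varepsilon_i=1/i$), and for every $i\ge i_0$ let $(p_i,(\sigma^i_j))$ be a feasible solution of the problem defining $\rho^*_{ik}$ with $\int_{\mathbf{Y}_k}p_i\,d\varphi_k\ge\rho^*_{ik}-\varepsilon_i$. Then $p_i(y)\le J^k(y)$ for all $y\in\mathbf{Y}_k$ and all $i\ge i_0$, and $$\int_{\mathbf{Y}_k}|J^k(y)-p_i(y)|\,d\varphi_k(y)\to0\quad\text{as } i\to\infty.$$ Moreover, let $\tilde p_{i_0}=p_{i_0}$ and $\tilde p_i(y)=\max[\tilde p_{i-1}(y),p_i(y)]$ for $i>i_0$. Then $\tilde p_i(y)\uparrow J^k(y)$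 for $\varphi_k$-almost all $y\in\mathbf{Y}_k$, and $\tilde p_i\to J^k$ $\varphi_k$-almost uniformly on $\mathbf{Y}_k$: for every $\varepsilon>0$ there is a Borel set $A\subseteq\mathbf{Y}_k$ with $\varphi_k(A)<\varepsilon$ such that $\tilde p_i\to J^k$ uniformly on $\mathbf{Y}_k\setminus A$. -/

import Mathlib

namespace JointMarginal

open MeasureTheory

noncomputable section

/-- The basic semi-algebraic set `K = {x ∈ ℝⁿ : g_j(x) ≥ 0, j = 1, …, m}`. -/
def feasibleSet {n m : ℕ} (g : Fin m → MvPolynomial (Fin n) ℝ) : Set (Fin n → ℝ) :=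
  {x | ∀ j, 0 ≤ MvPolynomial.eval x (g j)}

/-- The fiber `K_y = {x ∈ K : x_k = y}`. -/
def fiber {n m : ℕ} (g : Fin m → MvPolynomial (Fin n) ℝ) (k : Fin n) (y : ℝ) :
    Set (Fin n → ℝ) :=
  {x | x ∈ feasibleSet g ∧ x k = y}

/-- The orthogonal projection of `K` onto the `x_k`-coordinate axis. -/
def projection {n m : ℕ} (g : Fin m → MvPolynomial (Fin n) ℝ) (k : Fin n) : Set ℝ :=
  (fun x : Fin n → ℝ => x k) '' feasibleSet g

/-- The optimal value function `J^k(y) = min {f(x) : x ∈ K, x_k = y}`. -/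
def optValue {n m : ℕ} (f : MvPolynomial (Fin n) ℝ) (g : Fin m → MvPolynomial (Fin n) ℝ)
    (k : Fin n) (y : ℝ) : ℝ :=
  sInf ((fun x : Fin n → ℝ => MvPolynomial.eval x f) '' fiber g k y)

/-- The Archimedean assumption: for some `M > 0`, the polynomial `M - ‖x‖²` (Euclidean norm)
equals `σ₀ + ∑ j, σ_j g_j` for some sums of squares of polynomials `σ₀, σ_1, …, σ_m`. -/
def Archimedean {n m : ℕ} (g : Fin m → MvPolynomial (Fin n) ℝ) : Prop :=
  ∃ M : ℝ, 0 < M ∧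
    ∃ (σ₀ : MvPolynomial (Fin n) ℝ) (σ : Fin m → MvPolynomial (Fin n) ℝ),
      IsSumSq σ₀ ∧ (∀ j, IsSumSq (σ j)) ∧
      MvPolynomial.C M - ∑ l, MvPolynomial.X l ^ 2 = σ₀ + ∑ j, σ j * g j

/-- The uniform probability measure on the interval `[a, b]` (for `a < b`), as a Borel measure
on `ℝ`: Lebesgue measure conditioned on `[a, b]`. -/
def uniform (a b : ℝ) : Measure ℝ :=
  ProbabilityTheory.cond volume (Set.Icc a b)

/-- The moments `β_ℓ = ∫ y^ℓ dφ(y)`. -/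
def moment (φ : Measure ℝ) (l : ℕ) : ℝ := ∫ y, y ^ l ∂φ

/-- The linear functional `L_z(q) = ∑ α, q_α z_α` of a sequence `z = (z_α)`. -/
def riesz {n : ℕ} (z : (Fin n →₀ ℕ) → ℝ) (q : MvPolynomial (Fin n) ℝ) : ℝ :=
  ∑ α ∈ q.support, q.coeff α * z α

/-- The multi-indices `α ∈ ℕⁿ` with `|α| ≤ i`. -/
abbrev MultiIndex (n i : ℕ) : Type := {α : Fin n →₀ ℕ // α.degree ≤ i}

/-- The moment matrix `M_i(z)`, with entries `L_z(x^(α+β)) = z_(α+β)`, `|α|, |β| ≤ i`. -/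
def momentMatrix {n : ℕ} (i : ℕ) (z : (Fin n →₀ ℕ) → ℝ) :
    Matrix (MultiIndex n i) (MultiIndex n i) ℝ :=
  fun α β => z (α.1 + β.1)

/-- The localizing matrix `M_i(q z)`, with entries `∑ u, q_u z_(α+β+u)`, `|α|, |β| ≤ i`. -/
def localizingMatrix {n : ℕ} (i : ℕ) (q : MvPolynomial (Fin n) ℝ) (z : (Fin n →₀ ℕ) → ℝ) :
    Matrix (MultiIndex n i) (MultiIndex n i) ℝ :=
  fun α β => ∑ u ∈ q.support, q.coeff u * z (α.1 + β.1 + u)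

/-- `v = ⌈deg q / 2⌉`. -/
def halfDegree {n : ℕ} (q : MvPolynomial (Fin n) ℝ) : ℕ := (q.totalDegree + 1) / 2

/-- The smallest order `max_j v_j` for which the semidefinite relaxations are considered. -/
def minOrder {n m : ℕ} (g : Fin m → MvPolynomial (Fin n) ℝ) : ℕ :=
  Finset.univ.sup fun j => halfDegree (g j)

/-- Feasibility of `z` for the primal relaxation of order `i` (with `i ≥ max_j v_j`). -/
structure PrimalFeasible {n m : ℕ} (g : Fin m → MvPolynomial (Fin n) ℝ) (k : Fin n)
    (φ : Measure ℝ) (i : ℕ) (z : (Fin n →₀ ℕ) → ℝ) : Prop where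
  moment_psd : (momentMatrix i z).PosSemidef
  localizing_psd : ∀ j, (localizingMatrix (i - halfDegree (g j)) (g j) z).PosSemidef
  marginal : ∀ l ≤ 2 * i, riesz z (MvPolynomial.X k ^ l) = moment φ l

/-- The primal value `ρ_{ik}`, an extended real number. -/
def primalValue {n m : ℕ} (f : MvPolynomial (Fin n) ℝ) (g : Fin m → MvPolynomial (Fin n) ℝ)
    (k : Fin n) (φ : Measure ℝ) (i : ℕ) : EReal :=
  ⨅ (z : (Fin n →₀ ℕ) → ℝ) (_ : PrimalFeasible g k φ i z), ((riesz z f : ℝ) : EReal)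

/-- Feasibility of `(p, σ₀, σ)` for the dual relaxation of order `i`. -/
structure DualFeasible {n m : ℕ} (f : MvPolynomial (Fin n) ℝ)
    (g : Fin m → MvPolynomial (Fin n) ℝ) (k : Fin n) (i : ℕ) (p : Polynomial ℝ)
    (σ₀ : MvPolynomial (Fin n) ℝ) (σ : Fin m → MvPolynomial (Fin n) ℝ) : Prop where
  natDegree_le : p.natDegree ≤ 2 * i
  isSumSq_zero : IsSumSq σ₀
  isSumSq : ∀ j, IsSumSq (σ j)
  totalDegree_zero_le : σ₀.totalDegree ≤ 2 * i
  totalDegree_le : ∀ j, (σ j * g j).totalDegree ≤ 2 * i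
  identity : f - Polynomial.aeval (MvPolynomial.X k) p = σ₀ + ∑ j, σ j * g j

/-- The dual value `ρ*_{ik}`, an extended real number. -/
def dualValue {n m : ℕ} (f : MvPolynomial (Fin n) ℝ) (g : Fin m → MvPolynomial (Fin n) ℝ)
    (k : Fin n) (φ : Measure ℝ) (i : ℕ) : EReal :=
  ⨆ (p : Polynomial ℝ) (σ₀ : MvPolynomial (Fin n) ℝ) (σ : Fin m → MvPolynomial (Fin n) ℝ)
    (_ : DualFeasible f g k i p σ₀ σ), ((∫ y, p.eval y ∂φ : ℝ) : EReal)

/-- Almost uniform convergence on `Y` of a sequence of functions with respect to `φ`. -/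
def TendstoAlmostUniformlyOn (φ : Measure ℝ) (Y : Set ℝ) (q : ℕ → ℝ → ℝ) (J : ℝ → ℝ) : Prop :=
  ∀ ε : ℝ, 0 < ε → ∃ A ⊆ Y, MeasurableSet A ∧ φ A < ENNReal.ofReal ε ∧
    TendstoUniformlyOn q J Filter.atTop (Y \ A)

end

end JointMarginal

/-!
The proof is a sandwich `ρ*_i ≤ ρ_i ≤ ∫ J` together with a lower bound for `lim ρ*_i`.

*Lower bound* (`tendsto_dualValue`). The penalty values `min {f(x) + N |x_k - y| : x ∈ K}` are
continuous in `y` and increase to `J(y)` as `N → ∞` because `K` is compact. Weierstrass' theorem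
then gives polynomials `p < J` on `[a, b]` with `∫ p` arbitrarily close to `∫ J`
(`exists_polynomial_lt_optValue`). For such `p` the polynomial `f - p(x_k)` is positive on `K`, so
Putinar's Positivstellensatz makes `p` feasible for the dual relaxations of all large orders.

*Positivstellensatz* (`Archimedean.mem_quadraticModule_of_pos`). Let `M` be the quadratic module of
the `g j`, which is Archimedean by hypothesis. If `-1` is not in the quadratic module generated by
`M` and `-f`, that module lies in a maximal proper one, `S`. Then `S ∪ -S` is everything, each
variable is infinitesimally close modulo `S` to a real number, and the elements infinitesimal modulo
`S` form an ideal. Hence every polynomial `q` is infinitesimally close to `q(x)` for one point `x`,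
where the `g j` are nonnegative and `f(x) ≤ 0`. So if `f > 0` on `K`, then `s f - 1 ∈ M` for some
sum of squares `s`, and an algebraic identity (`mem_of_sumSq_mul_sub_one_mem`) yields `f ∈ M`.

*Weak duality* (`dualValue_le_primalValue`). The quadratic form of a localizing matrix is
`p ↦ L_z(p² q)`. Squares do not cancel in their leading terms, so the degree bounds on `σ_j g_j`
bound the degree of each square by the order of the corresponding matrix.

*Upper bound* (`primalValue_le_integral`). For a selection `y ↦ x(y)` of minimizers, the sequence
`z_α = ∫ x(y)^α dφ(y)` is feasible with value `∫ J`. No measurability of the selection is needed: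
by the M. Riesz extension theorem the integral extends to a positive functional on all bounded
functions, and positivity is all that feasibility requires.

Finally, for nearly optimal dual solutions `p_i ≤ J` and `∫ p_i → ∫ J`, which is convergence in
mean. The running maxima are squeezed between `p_i` and `J` and are monotone, so they converge
almost everywhere (`ae_tendsto_partialSups`), and Egorov's theorem gives almost uniform convergence.
-/

namespace JointMarginal

open MvPolynomial MeasureTheory Filter Topology

/-! ### Quadratic modules and Putinar's Positivstellensatz -/

section QuadraticModule

variable {A : Type*} [CommRing A]

/-- A subset `M` of a commutative ring is a *quadratic module* if it contains `1` and is closed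
under addition and under multiplication by squares. -/
structure IsQuadraticModule (M : Set A) : Prop where
  one_mem : (1 : A) ∈ M
  add_mem : ∀ {a b}, a ∈ M → b ∈ M → a + b ∈ M
  sq_mul_mem : ∀ (c : A) {a}, a ∈ M → c * c * a ∈ M

namespace IsQuadraticModule

variable {M : Set A} (hM : IsQuadraticModule M)
include hM

theorem zero_mem : (0 : A) ∈ M := by
  simpa using hM.sq_mul_mem 0 hM.one_mem

theorem sumSq_mul_mem {s a : A} (hs : IsSumSq s) (ha : a ∈ M) : s * a ∈ M := by
  induction hs with
  | zero => simpa using hM.zero_mem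
  | sq_add c _ ih => rw [add_mul]; exact hM.add_mem (hM.sq_mul_mem c ha) ih

theorem sumSq_mem {s : A} (hs : IsSumSq s) : s ∈ M := by
  simpa using hM.sumSq_mul_mem hs hM.one_mem

/-- The quadratic module obtained from `M` by adjoining `f`. -/
theorem adjoin (f : A) : IsQuadraticModule {a : A | ∃ m ∈ M, ∃ s, IsSumSq s ∧ a = m + s * f} where
  one_mem := ⟨1, hM.one_mem, 0, .zero, by simp⟩
  add_mem := by
    rintro _ _ ⟨m, hm, s, hs, rfl⟩ ⟨m', hm', s', hs', rfl⟩
    exact ⟨m + m', hM.add_mem hm hm', s + s', hs.add hs', by ring⟩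
  sq_mul_mem := by
    rintro c _ ⟨m, hm, s, hs, rfl⟩
    exact ⟨c * c * m, hM.sq_mul_mem c hm, c * c * s, (IsSumSq.mul_self c).mul hs, by ring⟩

/-- Every proper quadratic module lies in a maximal one. -/
theorem exists_maximal (h1 : (-1 : A) ∉ M) : ∃ S : Set A, M ⊆ S ∧ IsQuadraticModule S ∧
    (-1 : A) ∉ S ∧ ∀ S' : Set A, IsQuadraticModule S' → (-1 : A) ∉ S' → S ⊆ S' → S' ⊆ S := by
  obtain ⟨S, hMS, hS, hmax⟩ := zorn_subset_nonempty
    {S : Set A | IsQuadraticModule S ∧ (-1 : A) ∉ S} (fun c hc hchain hne => by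
      refine ⟨⋃₀ c, ⟨⟨?_, ?_, ?_⟩, ?_⟩, fun s hs => Set.subset_sUnion_of_mem hs⟩
      · obtain ⟨s, hs⟩ := hne
        exact ⟨s, hs, (hc hs).1.one_mem⟩
      · rintro a b ⟨s, hs, ha⟩ ⟨t, ht, hb⟩
        rcases hchain.total hs ht with h | h
        · exact ⟨t, ht, (hc ht).1.add_mem (h ha) hb⟩
        · exact ⟨s, hs, (hc hs).1.add_mem ha (h hb)⟩
      · rintro d a ⟨s, hs, ha⟩
        exact ⟨s, hs, (hc hs).1.sq_mul_mem d ha⟩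
      · rintro ⟨s, hs, ha⟩
        exact (hc hs).2 ha) M ⟨hM, h1⟩
  exact ⟨S, hMS, hS.1, hS.2, fun S' h h' hle => hmax ⟨h, h'⟩ hle⟩

end IsQuadraticModule

variable [Algebra ℝ A]

/-- A subset `M` of a real algebra is *Archimedean* if every element is bounded above, modulo `M`,
by a real constant. -/
def IsArchimedeanSet (M : Set A) : Prop := ∀ a : A, ∃ N : ℝ, algebraMap ℝ A N - a ∈ M

namespace IsQuadraticModule

variable {M : Set A} (hM : IsQuadraticModule M)
include hM

theorem smul_mem {r : ℝ} (hr : 0 ≤ r) {a : A} (ha : a ∈ M) : algebraMap ℝ A r * a ∈ M := by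
  have h := hM.sq_mul_mem (algebraMap ℝ A √r) ha
  rwa [← map_mul, Real.mul_self_sqrt hr] at h

theorem algebraMap_mem {r : ℝ} (hr : 0 ≤ r) : algebraMap ℝ A r ∈ M := by
  simpa using hM.smul_mem hr hM.one_mem

theorem of_smul_mem {r : ℝ} (hr : 0 < r) {a : A} (ha : algebraMap ℝ A r * a ∈ M) : a ∈ M := by
  have h := hM.smul_mem (inv_nonneg.2 hr.le) ha
  rwa [← mul_assoc, ← map_mul, inv_mul_cancel₀ hr.ne', map_one, one_mul] at h

theorem nonneg_of_algebraMap_mem (h1 : (-1 : A) ∉ M) {r : ℝ} (hr : algebraMap ℝ A r ∈ M) :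
    0 ≤ r := by
  by_contra! h
  refine h1 (hM.of_smul_mem (neg_pos.2 h) ?_)
  simpa using hr

/-- The elements `a` with `a` and `-a` in `M` form an ideal. Only closure under multiplication is
recorded; it follows from `4 c = (c + 1)² - (c - 1)²`. -/
theorem mul_mem_of_mem_of_neg_mem {a : A} (ha : a ∈ M) (ha' : -a ∈ M) (c : A) : c * a ∈ M := by
  refine hM.of_smul_mem (r := 4) (by norm_num) ?_
  have h := hM.add_mem (hM.sq_mul_mem (c + 1) ha) (hM.sq_mul_mem (c - 1) ha')
  convert h using 1
  rw [map_ofNat]; ring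

/-- The elements that are bounded modulo `M` on both sides are closed under taking squares. -/
theorem sub_sq_mem {N : ℝ} (hN : 0 < N) {a : A} (h₁ : algebraMap ℝ A N - a ∈ M)
    (h₂ : algebraMap ℝ A N + a ∈ M) : algebraMap ℝ A (N ^ 2) - a * a ∈ M := by
  -- `2 N (N² - a²) = (N + a)² (N - a) + (N - a)² (N + a)`
  refine hM.of_smul_mem (r := 2 * N) (by positivity) ?_
  have h := hM.add_mem (hM.sq_mul_mem (algebraMap ℝ A N + a) h₁)
    (hM.sq_mul_mem (algebraMap ℝ A N - a) h₂)
  convert h using 1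
  rw [map_mul, map_pow, map_ofNat]; ring

theorem bound_mono {N N' : ℝ} (h : N ≤ N') {a : A} (ha : algebraMap ℝ A N + a ∈ M) :
    algebraMap ℝ A N' + a ∈ M := by
  have := hM.add_mem ha (hM.algebraMap_mem (sub_nonneg.2 h))
  convert this using 1
  rw [map_sub]; ring

/-- A maximal proper quadratic module `M` satisfies `M ∪ -M = A`. -/
theorem mem_or_neg_mem (h1 : (-1 : A) ∉ M)
    (hmax : ∀ S : Set A, IsQuadraticModule S → (-1 : A) ∉ S → M ⊆ S → S ⊆ M) (a : A) :
    a ∈ M ∨ -a ∈ M := by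
  by_contra! hcon
  have key : ∀ b : A, b ∉ M → ∃ m ∈ M, ∃ s, IsSumSq s ∧ (-1 : A) = m + s * b := by
    intro b hb
    by_contra h
    refine hb (hmax _ (hM.adjoin b) h (fun m hm => ⟨m, hm, 0, .zero, by simp⟩) ?_)
    exact ⟨0, hM.zero_mem, 1, .one, by simp⟩
  obtain ⟨m, hm, s, hs, e⟩ := key a hcon.1
  obtain ⟨m', hm', s', hs', e'⟩ := key (-a) hcon.2
  -- `s` lies in `M ∩ -M`, because `s + s' + s * m' + s' * m = 0`
  have hneg : -s ∈ M := by
    have h := hM.add_mem (hM.sumSq_mem hs') (hM.add_mem (hM.sumSq_mul_mem hs hm')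
      (hM.sumSq_mul_mem hs' hm))
    convert h using 1
    linear_combination s' * e + s * e'
  have h := hM.mul_mem_of_mem_of_neg_mem (hM.sumSq_mem hs) hneg a
  refine h1 ?_
  rw [e, mul_comm s]
  exact hM.add_mem hm h

/-- Modulo a total proper Archimedean quadratic module, every element is infinitesimally close to
a real number. -/
theorem exists_real_part (h1 : (-1 : A) ∉ M) (htot : ∀ a : A, a ∈ M ∨ -a ∈ M)
    (harch : IsArchimedeanSet M) (a : A) :
    ∃ r : ℝ, ∀ ε : ℝ, 0 < ε → algebraMap ℝ A ε + (a - algebraMap ℝ A r) ∈ M ∧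
      algebraMap ℝ A ε - (a - algebraMap ℝ A r) ∈ M := by
  set T : Set ℝ := {r | a - algebraMap ℝ A r ∈ M}
  have hne : T.Nonempty := by
    obtain ⟨N, hN⟩ := harch (-a)
    refine ⟨-N, ?_⟩
    change a - algebraMap ℝ A (-N) ∈ M
    convert hN using 1
    rw [map_neg]; ring
  have hbdd : BddAbove T := by
    obtain ⟨N, hN⟩ := harch a
    refine ⟨N, fun r hr => ?_⟩
    have h := hM.add_mem hN hr
    rw [sub_add_sub_cancel, ← map_sub] at h
    linarith [hM.nonneg_of_algebraMap_mem h1 h]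
  refine ⟨sSup T, fun ε hε => ⟨?_, ?_⟩⟩
  · obtain ⟨r, hr, hlt⟩ := exists_lt_of_lt_csSup hne (sub_lt_self (sSup T) hε)
    have h := hM.add_mem hr (hM.algebraMap_mem (r := r - sSup T + ε) (by linarith))
    convert h using 1
    rw [map_add, map_sub]; ring
  · have hnot : sSup T + ε ∉ T := fun h => by linarith [le_csSup hbdd h]
    have h := (htot (a - algebraMap ℝ A (sSup T + ε))).resolve_left hnot
    convert h using 1
    rw [map_add]; ring

omit hM in
/-- The elements that are infinitesimal modulo an Archimedean quadratic module form an ideal. -/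
def infinitesimal (hM : IsQuadraticModule M) (harch : IsArchimedeanSet M) : Ideal A where
  carrier := {a | ∀ ε : ℝ, 0 < ε → algebraMap ℝ A ε + a ∈ M ∧ algebraMap ℝ A ε - a ∈ M}
  zero_mem' ε hε := by simpa using hM.algebraMap_mem hε.le
  add_mem' := by
    intro a b ha hb ε hε
    obtain ⟨ha₁, ha₂⟩ := ha (ε / 2) (half_pos hε)
    obtain ⟨hb₁, hb₂⟩ := hb (ε / 2) (half_pos hε)
    have e : algebraMap ℝ A ε = algebraMap ℝ A (ε / 2) + algebraMap ℝ A (ε / 2) := by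
      rw [← map_add, add_halves]
    constructor
    · convert hM.add_mem ha₁ hb₁ using 1
      rw [e]; ring
    · convert hM.add_mem ha₂ hb₂ using 1
      rw [e]; ring
  smul_mem' := by
    -- multiplication by a square, for an upper or lower bound separately
    have hsq : ∀ (c a : A), (∀ ε : ℝ, 0 < ε → algebraMap ℝ A ε + a ∈ M) →
        ∀ ε : ℝ, 0 < ε → algebraMap ℝ A ε + c * c * a ∈ M := by
      intro c a ha ε hε
      obtain ⟨N, hN⟩ := harch (c * c)
      have hN' : algebraMap ℝ A (|N| + 1) - c * c ∈ M := by
        have := hM.bound_mono (show N ≤ |N| + 1 by linarith [le_abs_self N])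
          (a := -(c * c)) (by simpa [sub_eq_add_neg] using hN)
        simpa [sub_eq_add_neg] using this
      have hpos : 0 < |N| + 1 := by positivity
      have h := hM.add_mem (hM.sq_mul_mem c (ha (ε / (|N| + 1)) (by positivity)))
        (hM.smul_mem (r := ε / (|N| + 1)) (by positivity) hN')
      convert h using 1
      have e : algebraMap ℝ A ε
          = algebraMap ℝ A (ε / (|N| + 1)) * algebraMap ℝ A (|N| + 1) := by
        rw [← map_mul, div_mul_cancel₀ _ hpos.ne']
      rw [e]; ring
    intro c a ha ε hε
    have h₁ : ∀ d : A, ∀ ε : ℝ, 0 < ε → algebraMap ℝ A ε + d * d * a ∈ M :=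
      fun d => hsq d a fun ε hε => (ha ε hε).1
    have h₂ : ∀ d : A, ∀ ε : ℝ, 0 < ε → algebraMap ℝ A ε + d * d * (-a) ∈ M :=
      fun d => hsq d (-a) fun ε hε => by simpa [sub_eq_add_neg] using (ha ε hε).2
    have e : algebraMap ℝ A (4 : ℝ) * algebraMap ℝ A ε
        = algebraMap ℝ A (2 * ε) + algebraMap ℝ A (2 * ε) := by
      rw [← map_mul, ← map_add]; congr 1; ring
    have e4 : algebraMap ℝ A (4 : ℝ) = 4 := map_ofNat _ _
    rw [smul_eq_mul]
    constructor
    · refine hM.of_smul_mem (r := 4) (by norm_num) ?_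
      convert hM.add_mem (h₁ (c + 1) (2 * ε) (by positivity))
        (h₂ (c - 1) (2 * ε) (by positivity)) using 1
      rw [mul_add, e, e4]; ring
    · refine hM.of_smul_mem (r := 4) (by norm_num) ?_
      convert hM.add_mem (h₂ (c + 1) (2 * ε) (by positivity))
        (h₁ (c - 1) (2 * ε) (by positivity)) using 1
      rw [mul_sub, e, e4]; ring

/-- If `s * f - 1 ∈ M` for a sum of squares `s` and `M` is Archimedean, then `f ∈ M`. The bound
`f + r ∈ M` is improved to `f + r - 1 / k² ∈ M` for a fixed `k`, until `r` becomes negative. -/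
theorem mem_of_sumSq_mul_sub_one_mem (harch : IsArchimedeanSet M) {s f : A} (hs : IsSumSq s)
    (h : s * f - 1 ∈ M) : f ∈ M := by
  -- `k` is chosen so that `2 k - s` and `2 k - 1 - s² f` lie in `M`
  obtain ⟨N₁, hN₁⟩ := harch s
  obtain ⟨N₂, hN₂⟩ := harch (1 + s * s * f)
  obtain ⟨N₃, hN₃⟩ := harch (-f)
  set k : ℝ := |N₁| + |N₂| + 1 with hk
  have hkpos : 0 < k := by positivity
  have hk₁ : algebraMap ℝ A (2 * k) + -s ∈ M :=
    hM.bound_mono (N := N₁) (by nlinarith [le_abs_self N₁, abs_nonneg N₂, abs_nonneg N₁])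
      (by simpa [sub_eq_add_neg] using hN₁)
  have hk₂ : algebraMap ℝ A (2 * k) + -(1 + s * s * f) ∈ M :=
    hM.bound_mono (N := N₂) (by nlinarith [le_abs_self N₂, abs_nonneg N₂, abs_nonneg N₁])
      (by simpa only [sub_eq_add_neg] using hN₂)
  have step : ∀ r : ℝ, 0 ≤ r → algebraMap ℝ A r + f ∈ M →
      algebraMap ℝ A (r - 1 / k ^ 2) + f ∈ M := by
    intro r hr hf
    -- `k² (f + r) - 1 = (k - s)² (f + r) + 2 k (s f - 1) + r s (2 k - s) + (2 k - 1 - s² f)`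
    refine hM.of_smul_mem (r := k ^ 2) (by positivity) ?_
    have h' := hM.add_mem (hM.add_mem (hM.sq_mul_mem (algebraMap ℝ A k - s) hf)
      (hM.smul_mem (r := 2 * k) (by positivity) h))
      (hM.add_mem (hM.smul_mem hr (hM.sumSq_mul_mem hs hk₁)) hk₂)
    convert h' using 1
    have e : algebraMap ℝ A (k ^ 2) * algebraMap ℝ A (r - 1 / k ^ 2)
        = algebraMap ℝ A k * algebraMap ℝ A k * algebraMap ℝ A r - 1 := by
      rw [← map_mul, ← map_mul, ← map_mul, ← map_one (algebraMap ℝ A), ← map_sub]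
      congr 1; field_simp
    rw [mul_add, e, map_pow, map_mul, map_ofNat]; ring
  have iter : ∀ j : ℕ, ∃ r : ℝ, r ≤ max 0 (|N₃| - j * (1 / k ^ 2)) ∧ algebraMap ℝ A r + f ∈ M := by
    intro j
    induction j with
    | zero =>
      refine ⟨|N₃|, by simp, hM.bound_mono (le_abs_self N₃) (by simpa using hN₃)⟩
    | succ j ih =>
      obtain ⟨r, hr, hrM⟩ := ih
      rcases le_or_gt r 0 with h0 | h0
      · exact ⟨r, h0.trans (le_max_left _ _), hrM⟩
      · refine ⟨r - 1 / k ^ 2, ?_, step r h0.le hrM⟩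
        have : r ≤ |N₃| - j * (1 / k ^ 2) := (le_max_iff.1 hr).resolve_left (not_le.2 h0)
        refine le_max_of_le_right ?_
        push_cast
        linarith
  obtain ⟨j, hj⟩ := exists_nat_gt (|N₃| * k ^ 2)
  obtain ⟨r, hr, hrM⟩ := iter j
  have hr0 : r ≤ 0 := by
    refine hr.trans (max_le le_rfl ?_)
    have : |N₃| = |N₃| * k ^ 2 * (1 / k ^ 2) := by field_simp
    have h2 : (0 : ℝ) < 1 / k ^ 2 := by positivity
    nlinarith
  simpa using hM.bound_mono hr0 hrM

end IsQuadraticModule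

end QuadraticModule

section Putinar

variable {n m : ℕ}

/-- **Representation theorem** for Archimedean quadratic modules of polynomials: a polynomial that
is positive at all points where the elements of `M` are nonnegative belongs to `M`. -/
theorem IsQuadraticModule.mem_of_pos {M : Set (MvPolynomial (Fin n) ℝ)} (hM : IsQuadraticModule M)
    (harch : IsArchimedeanSet M) {f : MvPolynomial (Fin n) ℝ}
    (hf : ∀ x : Fin n → ℝ, (∀ q ∈ M, 0 ≤ eval x q) → 0 < eval x f) : f ∈ M := by
  by_contra hfM
  have h1 : (-1 : MvPolynomial (Fin n) ℝ) ∉ {a | ∃ q ∈ M, ∃ s, IsSumSq s ∧ a = q + s * (-f)} := by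
    rintro ⟨q, hq, s, hs, e⟩
    refine hfM (hM.mem_of_sumSq_mul_sub_one_mem harch hs ?_)
    convert hq using 1
    linear_combination e
  obtain ⟨S, hMS, hS, hS1, hmax⟩ := (hM.adjoin (-f)).exists_maximal h1
  have hMS' : M ⊆ S := fun q hq => hMS ⟨q, hq, 0, .zero, by simp⟩
  have hfS : -f ∈ S := hMS ⟨0, hM.zero_mem, 1, .one, by simp⟩
  have hSarch : IsArchimedeanSet S := fun a => (harch a).imp fun _ h => hMS' h
  -- the real parts of the variables modulo `S` are the coordinates of a point
  choose x hx using fun i : Fin n =>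
    hS.exists_real_part hS1 (hS.mem_or_neg_mem hS1 hmax) hSarch (X i)
  have hI : ∀ q : MvPolynomial (Fin n) ℝ, q - C (eval x q) ∈ hS.infinitesimal hSarch := by
    intro q
    induction q using MvPolynomial.induction_on with
    | C r => simp
    | add p q hp hq =>
      convert (hS.infinitesimal hSarch).add_mem hp hq using 1
      rw [map_add, map_add]; ring
    | mul_X p i hp =>
      have hXi : X i - C (x i) ∈ hS.infinitesimal hSarch := hx i
      convert (hS.infinitesimal hSarch).add_mem (Ideal.mul_mem_left _ (X i) hp)
        (Ideal.mul_mem_left _ (C (eval x p)) hXi) using 1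
      rw [map_mul, eval_X, map_mul]; ring
  have hpos : ∀ q ∈ S, 0 ≤ eval x q := by
    intro q hq
    refine le_of_forall_pos_le_add fun ε hε => ?_
    refine hS.nonneg_of_algebraMap_mem hS1 ?_
    convert hS.add_mem hq (hI q ε hε).2 using 1
    rw [map_add, algebraMap_eq]; ring
  have := hf x fun q hq => hpos q (hMS' hq)
  have := hpos _ hfS
  rw [map_neg] at this
  linarith

/-- The quadratic module generated by the polynomials `g j`. -/
def quadraticModule (g : Fin m → MvPolynomial (Fin n) ℝ) : Set (MvPolynomial (Fin n) ℝ) :=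
  {q | ∃ (σ₀ : MvPolynomial (Fin n) ℝ) (σ : Fin m → MvPolynomial (Fin n) ℝ),
    IsSumSq σ₀ ∧ (∀ j, IsSumSq (σ j)) ∧ q = σ₀ + ∑ j, σ j * g j}

theorem isQuadraticModule_quadraticModule (g : Fin m → MvPolynomial (Fin n) ℝ) :
    IsQuadraticModule (quadraticModule g) where
  one_mem := ⟨1, 0, .one, fun _ => .zero, by simp⟩
  add_mem := by
    rintro _ _ ⟨s, σ, hs, hσ, rfl⟩ ⟨s', σ', hs', hσ', rfl⟩
    refine ⟨s + s', σ + σ', hs.add hs', fun j => (hσ j).add (hσ' j), ?_⟩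
    simp only [Pi.add_apply, add_mul, Finset.sum_add_distrib]
    ring
  sq_mul_mem := by
    rintro c _ ⟨s, σ, hs, hσ, rfl⟩
    refine ⟨c * c * s, fun j => c * c * σ j, (IsSumSq.mul_self c).mul hs,
      fun j => (IsSumSq.mul_self c).mul (hσ j), ?_⟩
    rw [mul_add, Finset.mul_sum]
    simp only [mul_assoc]

theorem mem_quadraticModule (g : Fin m → MvPolynomial (Fin n) ℝ) (j : Fin m) :
    g j ∈ quadraticModule g := by
  refine ⟨0, Pi.single j 1, .zero, fun i => ?_, ?_⟩
  · rcases eq_or_ne i j with rfl | h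
    · simp
    · simp [h]
  · simp [Pi.single_apply]

theorem eval_nonneg_of_isSumSq {s : MvPolynomial (Fin n) ℝ} (hs : IsSumSq s) (x : Fin n → ℝ) :
    0 ≤ eval x s := by
  induction hs with
  | zero => simp
  | sq_add a _ ih => rw [map_add, map_mul]; exact add_nonneg (mul_self_nonneg _) ih

theorem eval_nonneg_of_mem_feasibleSet {g : Fin m → MvPolynomial (Fin n) ℝ} {x : Fin n → ℝ}
    (hx : x ∈ feasibleSet g) {σ₀ : MvPolynomial (Fin n) ℝ} {σ : Fin m → MvPolynomial (Fin n) ℝ}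
    (h₀ : IsSumSq σ₀) (hσ : ∀ j, IsSumSq (σ j)) : 0 ≤ eval x (σ₀ + ∑ j, σ j * g j) := by
  rw [map_add, map_sum]
  refine add_nonneg (eval_nonneg_of_isSumSq h₀ x) (Finset.sum_nonneg fun j _ => ?_)
  rw [map_mul]
  exact mul_nonneg (eval_nonneg_of_isSumSq (hσ j) x) (hx j)

/-- The bound on `‖x‖²` bounds every variable modulo the quadratic module, and the bounded elements
form a subring. -/
theorem Archimedean.isArchimedeanSet {g : Fin m → MvPolynomial (Fin n) ℝ} (hg : Archimedean g) :
    IsArchimedeanSet (quadraticModule g) := by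
  have hQ := isQuadraticModule_quadraticModule g
  obtain ⟨B, hB, σ₀, σ, h₀, hσ, e⟩ := hg
  have hball : C B - ∑ l, X l ^ 2 ∈ quadraticModule g := ⟨σ₀, σ, h₀, hσ, e⟩
  have hX : ∀ i, C B - X i * X i ∈ quadraticModule g := by
    intro i
    have hs : IsSumSq (∑ l ∈ Finset.univ.erase i, (X l ^ 2 : MvPolynomial (Fin n) ℝ)) :=
      IsSumSq.sum fun l _ => by rw [pow_two]; exact .mul_self _
    convert hQ.add_mem hball (hQ.sumSq_mem hs) using 1
    rw [← Finset.add_sum_erase _ _ (Finset.mem_univ i)]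
    ring
  have key : ∀ q : MvPolynomial (Fin n) ℝ, ∃ N : ℝ, 0 < N ∧
      algebraMap ℝ (MvPolynomial (Fin n) ℝ) N - q ∈ quadraticModule g ∧
      algebraMap ℝ (MvPolynomial (Fin n) ℝ) N + q ∈ quadraticModule g := by
    have hadd : ∀ {p q : MvPolynomial (Fin n) ℝ} {N N' : ℝ},
        C N - p ∈ quadraticModule g ∧ C N + p ∈ quadraticModule g →
        C N' - q ∈ quadraticModule g ∧ C N' + q ∈ quadraticModule g →
        C (N + N') - (p + q) ∈ quadraticModule g ∧ C (N + N') + (p + q) ∈ quadraticModule g := by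
      rintro p q N N' ⟨h₁, h₂⟩ ⟨h₃, h₄⟩
      constructor
      · convert hQ.add_mem h₁ h₃ using 1
        rw [map_add]; ring
      · convert hQ.add_mem h₂ h₄ using 1
        rw [map_add]; ring
    intro q
    simp only [algebraMap_eq]
    induction q using MvPolynomial.induction_on with
    | C r =>
      refine ⟨|r| + 1, by positivity, ?_, ?_⟩
      · rw [← map_sub, ← algebraMap_eq]
        exact hQ.algebraMap_mem (by linarith [le_abs_self r])
      · rw [← map_add, ← algebraMap_eq]
        exact hQ.algebraMap_mem (by linarith [neg_abs_le r])
    | add p q hp hq =>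
      obtain ⟨N, hN, h⟩ := hp
      obtain ⟨N', hN', h'⟩ := hq
      exact ⟨N + N', by positivity, hadd h h'⟩
    | mul_X p i hp =>
      obtain ⟨N, hN, h⟩ := hp
      -- `B + 1/4 ± X = (B - X²) + (X ± 1/2)²`
      have hXi : C (B + 1 / 4) - X i ∈ quadraticModule g ∧
          C (B + 1 / 4) + X i ∈ quadraticModule g := by
        have e4 : (C (1 / 4 : ℝ) : MvPolynomial (Fin n) ℝ) = C (1 / 2) * C (1 / 2) := by
          rw [← map_mul]; norm_num
        have e2 : (C (1 / 2 : ℝ) : MvPolynomial (Fin n) ℝ) + C (1 / 2) = 1 := by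
          rw [← map_add, ← C_1]; norm_num
        constructor
        · convert hQ.add_mem (hX i) (hQ.sumSq_mem (.mul_self (X i - C (1 / 2)))) using 1
          rw [map_add, e4]; linear_combination (X i) * e2
        · convert hQ.add_mem (hX i) (hQ.sumSq_mem (.mul_self (X i + C (1 / 2)))) using 1
          rw [map_add, e4]; linear_combination (-X i) * e2
      have hm : C (-(B + 1 / 4)) = -(C (B + 1 / 4) : MvPolynomial (Fin n) ℝ) := map_neg _ _
      set L : ℝ := N + (B + 1 / 4)
      have hL : 0 < L := by positivity
      have hp₁ := hadd h hXi
      have hp₂ : C L - (p + -X i) ∈ quadraticModule g ∧ C L + (p + -X i) ∈ quadraticModule g :=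
        hadd h ⟨by simpa using hXi.2, by simpa [sub_eq_add_neg] using hXi.1⟩
      -- `4 p X = (p + X)² - (p - X)²`
      have hs₁ := hQ.sub_sq_mem hL hp₁.1 hp₁.2
      have hs₂ := hQ.sub_sq_mem hL hp₂.1 hp₂.2
      have e4 : (C (4 : ℝ) : MvPolynomial (Fin n) ℝ) = 4 := map_ofNat _ _
      simp only [algebraMap_eq] at hs₁ hs₂
      refine ⟨L ^ 2, by positivity, ?_, ?_⟩
      · refine hQ.of_smul_mem (r := 4) (by norm_num) ?_
        rw [algebraMap_eq, e4]
        convert hQ.add_mem (hQ.smul_mem (r := 3) (by norm_num)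
          (hQ.algebraMap_mem (sq_nonneg L)))
          (hQ.add_mem hs₁ (hQ.sumSq_mem (.mul_self (p + -X i)))) using 1
        rw [algebraMap_eq, show (C (3 : ℝ) : MvPolynomial (Fin n) ℝ) = 3 from map_ofNat _ _]
        ring
      · refine hQ.of_smul_mem (r := 4) (by norm_num) ?_
        rw [algebraMap_eq, e4]
        convert hQ.add_mem (hQ.smul_mem (r := 3) (by norm_num)
          (hQ.algebraMap_mem (sq_nonneg L)))
          (hQ.add_mem hs₂ (hQ.sumSq_mem (.mul_self (p + X i)))) using 1
        rw [algebraMap_eq, show (C (3 : ℝ) : MvPolynomial (Fin n) ℝ) = 3 from map_ofNat _ _]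
        ring
  exact fun a => (key a).imp fun _ h => h.2.1

/-- **Putinar's Positivstellensatz.** -/
theorem Archimedean.mem_quadraticModule_of_pos {g : Fin m → MvPolynomial (Fin n) ℝ}
    (hg : Archimedean g) {f : MvPolynomial (Fin n) ℝ}
    (hf : ∀ x ∈ feasibleSet g, 0 < eval x f) : f ∈ quadraticModule g :=
  (isQuadraticModule_quadraticModule g).mem_of_pos hg.isArchimedeanSet fun x hx =>
    hf x fun j => hx _ (mem_quadraticModule g j)

end Putinar

/-! ### The optimal value function and its regularizations -/

section Value

variable {n m : ℕ} {f : MvPolynomial (Fin n) ℝ} {g : Fin m → MvPolynomial (Fin n) ℝ} {k : Fin n}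
  {a b : ℝ}

theorem Archimedean.isCompact_feasibleSet (hg : Archimedean g) : IsCompact (feasibleSet g) := by
  have hclosed : IsClosed (feasibleSet g) := by
    have : feasibleSet g = ⋂ j, {x | 0 ≤ eval x (g j)} := by ext; simp [feasibleSet]
    rw [this]
    exact isClosed_iInter fun j => isClosed_le continuous_const (continuous_eval _)
  obtain ⟨B, hB, σ₀, σ, h₀, hσ, e⟩ := hg
  refine (isCompact_closedBall (0 : Fin n → ℝ) √B).of_isClosed_subset hclosed fun x hx => ?_
  have h := eval_nonneg_of_mem_feasibleSet hx h₀ hσ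
  rw [← e] at h
  simp only [map_sub, eval_C, map_sum, map_pow, eval_X, sub_nonneg] at h
  rw [mem_closedBall_zero_iff, pi_norm_le_iff_of_nonneg (Real.sqrt_nonneg _)]
  intro i
  rw [Real.norm_eq_abs]
  exact Real.abs_le_sqrt ((Finset.single_le_sum (f := fun i => x i ^ 2)
    (fun i _ => sq_nonneg _) (Finset.mem_univ i)).trans h)

theorem mem_Icc_of_mem_feasibleSet (hY : projection g k = Set.Icc a b) {x : Fin n → ℝ}
    (hx : x ∈ feasibleSet g) : x k ∈ Set.Icc a b :=
  hY ▸ Set.mem_image_of_mem _ hx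

theorem fiber_nonempty (hY : projection g k = Set.Icc a b) {y : ℝ} (hy : y ∈ Set.Icc a b) :
    (fiber g k y).Nonempty := by
  rw [← hY] at hy
  obtain ⟨x, hx, rfl⟩ := hy
  exact ⟨x, hx, rfl⟩

theorem fiber_eq_empty (hY : projection g k = Set.Icc a b) {y : ℝ} (hy : y ∉ Set.Icc a b) :
    fiber g k y = ∅ := by
  rw [Set.eq_empty_iff_forall_notMem]
  rintro x ⟨hx, rfl⟩
  exact hy (mem_Icc_of_mem_feasibleSet hY hx)

theorem isCompact_fiber (hg : Archimedean g) (y : ℝ) : IsCompact (fiber g k y) :=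
  hg.isCompact_feasibleSet.inter_right (isClosed_eq (continuous_apply k) continuous_const)

theorem isLeast_optValue (hg : Archimedean g) (f : MvPolynomial (Fin n) ℝ)
    (hY : projection g k = Set.Icc a b) {y : ℝ} (hy : y ∈ Set.Icc a b) :
    IsLeast ((fun x : Fin n → ℝ => eval x f) '' fiber g k y) (optValue f g k y) :=
  ((isCompact_fiber hg y).image (continuous_eval f)).isLeast_sInf
    ((fiber_nonempty hY hy).image _)

theorem optValue_of_notMem (hY : projection g k = Set.Icc a b) {y : ℝ} (hy : y ∉ Set.Icc a b) :
    optValue f g k y = 0 := by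
  simp [optValue, fiber_eq_empty hY hy]

theorem optValue_le (hg : Archimedean g) (hY : projection g k = Set.Icc a b) {x : Fin n → ℝ}
    (hx : x ∈ feasibleSet g) : optValue f g k (x k) ≤ eval x f :=
  (isLeast_optValue hg f hY (mem_Icc_of_mem_feasibleSet hY hx)).2 ⟨x, ⟨hx, rfl⟩, rfl⟩

theorem le_optValue (hg : Archimedean g) (hY : projection g k = Set.Icc a b) {y c : ℝ}
    (hy : y ∈ Set.Icc a b) (h : ∀ x ∈ feasibleSet g, x k = y → c ≤ eval x f) :
    c ≤ optValue f g k y := by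
  obtain ⟨x, ⟨hx, hxy⟩, e⟩ := (isLeast_optValue hg f hY hy).1
  exact e ▸ h x hx hxy

/-- The `N`-Lipschitz regularization of the optimal value function: the constraint `x_k = y` is
replaced by the penalty `N |x_k - y|`. -/
noncomputable def penaltyValue (f : MvPolynomial (Fin n) ℝ) (g : Fin m → MvPolynomial (Fin n) ℝ)
    (k : Fin n) (N : ℕ) (y : ℝ) : ℝ :=
  sInf ((fun x : Fin n → ℝ => eval x f + N * |x k - y|) '' feasibleSet g)

theorem continuous_penaltyValue (hg : Archimedean g) (f : MvPolynomial (Fin n) ℝ) (k : Fin n)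
    (N : ℕ) : Continuous (penaltyValue f g k N) := by
  refine hg.isCompact_feasibleSet.continuous_sInf
    (f := fun (y : ℝ) (x : Fin n → ℝ) => eval x f + N * |x k - y|) ?_
  have h1 : Continuous fun p : ℝ × (Fin n → ℝ) => eval p.2 f :=
    (continuous_eval f).comp continuous_snd
  have h2 : Continuous fun p : ℝ × (Fin n → ℝ) => p.2 k :=
    (continuous_apply k).comp continuous_snd
  exact h1.add (continuous_const.mul (h2.sub continuous_fst).abs)

theorem continuous_penalized (f : MvPolynomial (Fin n) ℝ) (k : Fin n) (N : ℕ) (y : ℝ) :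
    Continuous fun x : Fin n → ℝ => eval x f + N * |x k - y| :=
  (continuous_eval f).add (continuous_const.mul ((continuous_apply k).sub continuous_const).abs)

theorem penaltyValue_le (hg : Archimedean g) (N : ℕ) (y : ℝ) {x : Fin n → ℝ}
    (hx : x ∈ feasibleSet g) : penaltyValue f g k N y ≤ eval x f + N * |x k - y| :=
  csInf_le (hg.isCompact_feasibleSet.image (continuous_penalized f k N y)).bddBelow ⟨x, hx, rfl⟩

theorem le_penaltyValue (hne : (feasibleSet g).Nonempty) {N : ℕ} {y c : ℝ}
    (h : ∀ x ∈ feasibleSet g, c ≤ eval x f + N * |x k - y|) : c ≤ penaltyValue f g k N y := by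
  refine le_csInf (hne.image _) ?_
  rintro _ ⟨x, hx, rfl⟩
  exact h x hx

theorem penaltyValue_le_optValue (hg : Archimedean g) (hY : projection g k = Set.Icc a b) (N : ℕ)
    {y : ℝ} (hy : y ∈ Set.Icc a b) : penaltyValue f g k N y ≤ optValue f g k y :=
  le_optValue hg hY hy fun x hx hxy => by
    simpa [hxy] using penaltyValue_le (f := f) (k := k) hg N y hx

theorem exists_bound (hg : Archimedean g) (f : MvPolynomial (Fin n) ℝ) :
    ∃ B : ℝ, 0 ≤ B ∧ ∀ x ∈ feasibleSet g, |eval x f| ≤ B := by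
  obtain ⟨B, hB⟩ := hg.isCompact_feasibleSet.exists_bound_of_continuousOn
    (continuous_eval f).continuousOn
  exact ⟨max B 0, le_max_right _ _, fun x hx => (hB x hx).trans (le_max_left _ _)⟩

/-- The penalty values converge pointwise. Below any level `c < J(y)`, the sublevel set of `f` is
compact and at positive distance from the hyperplane `x_k = y`, so the penalty is large there. -/
theorem tendsto_penaltyValue (hg : Archimedean g) (f : MvPolynomial (Fin n) ℝ)
    (hY : projection g k = Set.Icc a b) {y : ℝ} (hy : y ∈ Set.Icc a b) :
    Tendsto (fun N => penaltyValue f g k N y) atTop (𝓝 (optValue f g k y)) := by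
  have hne : (feasibleSet g).Nonempty := (fiber_nonempty hY hy).mono fun _ h => h.1
  refine tendsto_order.2 ⟨fun c hc => ?_, fun c hc => Eventually.of_forall fun N =>
    (penaltyValue_le_optValue hg hY N hy).trans_lt hc⟩
  obtain ⟨c', hcc', hc'⟩ := exists_between hc
  obtain ⟨B, hB0, hB⟩ := exists_bound hg f
  set T := feasibleSet g ∩ {x | eval x f ≤ c'}
  have hT : IsCompact T :=
    hg.isCompact_feasibleSet.inter_right (isClosed_le (continuous_eval f) continuous_const)
  have hdist : ∃ δ : ℝ, 0 < δ ∧ ∀ x ∈ T, δ ≤ |x k - y| := by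
    rcases T.eq_empty_or_nonempty with h | h
    · exact ⟨1, one_pos, by simp [h]⟩
    · obtain ⟨x, hx, hmin⟩ := hT.exists_isMinOn h
        (f := fun x : Fin n → ℝ => |x k - y|)
        ((continuous_apply k).sub continuous_const).abs.continuousOn
      refine ⟨|x k - y|, abs_pos.2 (sub_ne_zero.2 ?_), fun z hz => hmin hz⟩
      rintro rfl
      exact absurd ((optValue_le hg hY hx.1).trans hx.2) (not_le.2 hc')
  obtain ⟨δ, hδ, hT'⟩ := hdist
  obtain ⟨N₀, hN₀⟩ := exists_nat_gt ((c' + B) / δ)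
  filter_upwards [eventually_ge_atTop N₀] with N hN
  refine hcc'.trans_le (le_penaltyValue hne fun x hx => ?_)
  by_cases hxc : eval x f ≤ c'
  · have h1 := hT' x ⟨hx, hxc⟩
    have h2 := neg_le_of_abs_le (hB x hx)
    rw [div_lt_iff₀ hδ] at hN₀
    have h3 : (N₀ : ℝ) * δ ≤ N * |x k - y| :=
      mul_le_mul (by exact_mod_cast hN) h1 hδ.le (by positivity)
    linarith
  · have : 0 ≤ (N : ℝ) * |x k - y| := by positivity
    linarith

theorem measurable_optValue (hg : Archimedean g) (f : MvPolynomial (Fin n) ℝ)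
    (hY : projection g k = Set.Icc a b) : Measurable (optValue f g k) := by
  refine measurable_of_tendsto_metrizable
    (f := fun N => (Set.Icc a b).indicator (penaltyValue f g k N))
    (fun N => (continuous_penaltyValue hg f k N).measurable.indicator measurableSet_Icc)
    (tendsto_pi_nhds.2 fun y => ?_)
  by_cases hy : y ∈ Set.Icc a b
  · simpa [hy] using tendsto_penaltyValue hg f hY hy
  · simp [hy, optValue_of_notMem hY hy]

theorem abs_optValue_le (hg : Archimedean g) (hY : projection g k = Set.Icc a b) {B : ℝ}
    (hB : ∀ x ∈ feasibleSet g, |eval x f| ≤ B) {y : ℝ} (hy : y ∈ Set.Icc a b) :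
    |optValue f g k y| ≤ B := by
  obtain ⟨x, hx, e⟩ := (isLeast_optValue hg f hY hy).1
  exact e ▸ hB x hx.1

theorem isProbabilityMeasure_uniform (hab : a < b) : IsProbabilityMeasure (uniform a b) :=
  ProbabilityTheory.cond_isProbabilityMeasure_of_finite (by simp [hab]) (by simp)

theorem ae_mem_Icc_uniform (a b : ℝ) : ∀ᵐ y ∂uniform a b, y ∈ Set.Icc a b :=
  ProbabilityTheory.ae_cond_mem measurableSet_Icc

theorem integrable_uniform_of_bounded (hab : a < b) {h : ℝ → ℝ} (hm : Measurable h) {B : ℝ}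
    (hB : ∀ y ∈ Set.Icc a b, |h y| ≤ B) : Integrable h (uniform a b) := by
  have := isProbabilityMeasure_uniform hab
  refine Integrable.of_bound hm.aestronglyMeasurable B ?_
  filter_upwards [ae_mem_Icc_uniform a b] with y hy using hB y hy

theorem integrable_uniform_of_continuous (hab : a < b) {h : ℝ → ℝ} (hc : Continuous h) :
    Integrable h (uniform a b) := by
  obtain ⟨B, hB⟩ := (isCompact_Icc (a := a) (b := b)).exists_bound_of_continuousOn hc.continuousOn
  exact integrable_uniform_of_bounded hab hc.measurable hB

theorem integrable_optValue (hg : Archimedean g) (f : MvPolynomial (Fin n) ℝ) (hab : a < b)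
    (hY : projection g k = Set.Icc a b) : Integrable (optValue f g k) (uniform a b) := by
  obtain ⟨B, -, hB⟩ := exists_bound hg f
  exact integrable_uniform_of_bounded hab (measurable_optValue hg f hY)
    fun y hy => abs_optValue_le hg hY hB hy

theorem tendsto_integral_penaltyValue (hg : Archimedean g) (f : MvPolynomial (Fin n) ℝ)
    (hab : a < b) (hY : projection g k = Set.Icc a b) :
    Tendsto (fun N => ∫ y, penaltyValue f g k N y ∂uniform a b) atTop
      (𝓝 (∫ y, optValue f g k y ∂uniform a b)) := by
  have := isProbabilityMeasure_uniform hab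
  obtain ⟨B, hB0, hB⟩ := exists_bound hg f
  refine tendsto_integral_of_dominated_convergence (fun _ => B)
    (fun N => (continuous_penaltyValue hg f k N).aestronglyMeasurable) (integrable_const _)
    (fun N => ?_) ?_
  · filter_upwards [ae_mem_Icc_uniform a b] with y hy
    have hne : (feasibleSet g).Nonempty := (fiber_nonempty hY hy).mono fun _ h => h.1
    refine abs_le.2 ⟨le_penaltyValue hne fun x hx => ?_,
      (penaltyValue_le_optValue hg hY N hy).trans
        ((le_abs_self _).trans (abs_optValue_le hg hY hB hy))⟩
    have : 0 ≤ (N : ℝ) * |x k - y| := by positivity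
    linarith [neg_le_of_abs_le (hB x hx)]
  · filter_upwards [ae_mem_Icc_uniform a b] with y hy using tendsto_penaltyValue hg f hY hy

/-- Polynomials strictly below the optimal value function come arbitrarily close to it in the mean:
by Weierstrass' theorem they approximate the penalty values uniformly from below. -/
theorem exists_polynomial_lt_optValue (hg : Archimedean g) (f : MvPolynomial (Fin n) ℝ)
    (hab : a < b) (hY : projection g k = Set.Icc a b) {c : ℝ}
    (hc : c < ∫ y, optValue f g k y ∂uniform a b) :
    ∃ p : Polynomial ℝ, (∀ y ∈ Set.Icc a b, p.eval y < optValue f g k y) ∧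
      c < ∫ y, p.eval y ∂uniform a b := by
  have := isProbabilityMeasure_uniform hab
  obtain ⟨N, hN⟩ := ((tendsto_integral_penaltyValue hg f hab hY).eventually_const_lt hc).exists
  set ε := ((∫ y, penaltyValue f g k N y ∂uniform a b) - c) / 3 with hε
  have hε0 : 0 < ε := by rw [hε]; linarith
  obtain ⟨p, hp⟩ := exists_polynomial_near_of_continuousOn a b (penaltyValue f g k N)
    (continuous_penaltyValue hg f k N).continuousOn ε hε0
  -- shifting by `ε` makes the approximation strictly smaller than the penalty value
  refine ⟨p - Polynomial.C ε, fun y hy => ?_, ?_⟩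
  · have h1 := (abs_lt.1 (hp y hy)).2
    have h2 := penaltyValue_le_optValue (f := f) hg hY N hy
    simp only [Polynomial.eval_sub, Polynomial.eval_C]
    linarith
  · have h : ∫ y, (penaltyValue f g k N y - 2 * ε) ∂uniform a b
        ≤ ∫ y, (p - Polynomial.C ε).eval y ∂uniform a b := by
      refine integral_mono_ae ?_ ?_ ?_
      · exact (integrable_uniform_of_continuous hab (continuous_penaltyValue hg f k N)).sub
          (integrable_const _)
      · exact integrable_uniform_of_continuous hab (Polynomial.continuous _)
      · filter_upwards [ae_mem_Icc_uniform a b] with y hy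
        have h1 := (abs_lt.1 (hp y hy)).1
        simp only [Polynomial.eval_sub, Polynomial.eval_C]
        linarith
    rw [integral_sub (integrable_uniform_of_continuous hab (continuous_penaltyValue hg f k N))
      (integrable_const _)] at h
    simp only [integral_const, probReal_univ, one_smul] at h
    linarith

end Value

/-! ### Degrees of sums of squares -/

section Degree

variable {n : ℕ}

/-- If the leading coefficients of `p` and `q` are nonnegative, they cannot cancel. -/
theorem leadingCoeff_add_nonneg {p q : MvPolynomial (Fin n) ℝ}
    (hp : 0 ≤ MonomialOrder.degLex.leadingCoeff p) (hq : 0 ≤ MonomialOrder.degLex.leadingCoeff q) :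
    0 ≤ MonomialOrder.degLex.leadingCoeff (p + q) ∧ p.totalDegree ≤ (p + q).totalDegree := by
  set d := MonomialOrder.degLex (σ := Fin n)
  rcases eq_or_ne p 0 with rfl | hp0
  · simpa using hq
  rcases eq_or_ne q 0 with rfl | hq0
  · simpa using hp
  rcases lt_trichotomy (d.toSyn (d.degree p)) (d.toSyn (d.degree q)) with h | h | h
  · have e := d.degree_add_eq_right_of_lt h
    refine ⟨?_, degLex_totalDegree_monotone ?_⟩
    · rw [add_comm, d.leadingCoeff_add_of_lt h]; exact hq
    · change d.toSyn (d.degree p) ≤ d.toSyn (d.degree (p + q))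
      rw [e]; exact h.le
  · have hdeg : d.degree p = d.degree q := d.toSyn.injective h
    have hp' : 0 < d.leadingCoeff p := hp.lt_of_ne' (d.leadingCoeff_ne_zero_iff.2 hp0)
    have hc : (p + q).coeff (d.degree p) = d.leadingCoeff p + d.leadingCoeff q := by
      rw [coeff_add, MonomialOrder.leadingCoeff, MonomialOrder.leadingCoeff, hdeg]
    have hle : d.toSyn (d.degree p) ≤ d.toSyn (d.degree (p + q)) :=
      d.le_degree (mem_support_iff.2 (by rw [hc]; positivity))
    have heq : d.degree (p + q) = d.degree p := by
      refine d.toSyn.injective (le_antisymm ?_ hle)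
      have := d.degree_add_le (f := p) (g := q)
      rwa [h, sup_idem, ← h] at this
    refine ⟨?_, degLex_totalDegree_monotone hle⟩
    rw [MonomialOrder.leadingCoeff, heq, hc]
    positivity
  · have e := d.degree_add_of_lt h
    refine ⟨?_, degLex_totalDegree_monotone ?_⟩
    · rw [d.leadingCoeff_add_of_lt h]; exact hp
    · change d.toSyn (d.degree p) ≤ d.toSyn (d.degree (p + q))
      rw [e]

theorem leadingCoeff_mul_self_nonneg (p : MvPolynomial (Fin n) ℝ) :
    0 ≤ MonomialOrder.degLex.leadingCoeff (p * p) := by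
  rw [MonomialOrder.leadingCoeff_mul]; exact mul_self_nonneg _

theorem leadingCoeff_nonneg_of_isSumSq {s : MvPolynomial (Fin n) ℝ} (hs : IsSumSq s) :
    0 ≤ MonomialOrder.degLex.leadingCoeff s := by
  induction hs with
  | zero => simp
  | sq_add p _ ih => exact (leadingCoeff_add_nonneg (leadingCoeff_mul_self_nonneg p) ih).1

/-- A linear functional that is nonnegative on the squares of polynomials of degree at most `d` is
nonnegative on the sums of squares of degree at most `2 d + 1`: no square in such a sum has a larger
degree than the sum. -/
theorem nonneg_of_isSumSq {L : MvPolynomial (Fin n) ℝ →ₗ[ℝ] ℝ} {d : ℕ}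
    (hL : ∀ p : MvPolynomial (Fin n) ℝ, p.totalDegree ≤ d → 0 ≤ L (p * p))
    {s : MvPolynomial (Fin n) ℝ} (hs : IsSumSq s) (hd : s.totalDegree ≤ 2 * d + 1) : 0 ≤ L s := by
  induction hs with
  | zero => simp
  | sq_add p ht ih =>
    rename_i t
    have h₁ := (leadingCoeff_add_nonneg (leadingCoeff_mul_self_nonneg p)
      (leadingCoeff_nonneg_of_isSumSq ht)).2
    have h₂ := (leadingCoeff_add_nonneg (leadingCoeff_nonneg_of_isSumSq ht)
      (leadingCoeff_mul_self_nonneg p)).2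
    rw [add_comm t] at h₂
    rw [map_add]
    refine add_nonneg (hL p ?_) (ih (h₂.trans hd))
    rcases eq_or_ne p 0 with rfl | hp
    · simp
    · rw [totalDegree_mul_of_isDomain hp hp] at h₁
      lia

end Degree

/-! ### Moment and localizing matrices, and weak duality -/

section Duality

variable {n m : ℕ}

/-- The functional `L_z` as a linear map. -/
noncomputable def rieszLinear (z : (Fin n →₀ ℕ) → ℝ) : MvPolynomial (Fin n) ℝ →ₗ[ℝ] ℝ :=
  (basisMonomials (Fin n) ℝ).constr ℝ z

theorem rieszLinear_monomial (z : (Fin n →₀ ℕ) → ℝ) (α : Fin n →₀ ℕ) (c : ℝ) :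
    rieszLinear z (monomial α c) = c * z α := by
  have h : monomial α c = c • basisMonomials (Fin n) ℝ α := by simp [smul_monomial]
  rw [h, map_smul, rieszLinear, Module.Basis.constr_basis, smul_eq_mul]

theorem rieszLinear_apply (z : (Fin n →₀ ℕ) → ℝ) (q : MvPolynomial (Fin n) ℝ) :
    rieszLinear z q = riesz z q := by
  conv_lhs => rw [q.as_sum]
  rw [map_sum]
  exact Finset.sum_congr rfl fun α _ => rieszLinear_monomial z α _

theorem rieszLinear_monomial_mul (z : (Fin n →₀ ℕ) → ℝ) (α : Fin n →₀ ℕ) (c : ℝ)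
    (q : MvPolynomial (Fin n) ℝ) :
    rieszLinear z (monomial α c * q) = c * ∑ u ∈ q.support, q.coeff u * z (α + u) := by
  conv_lhs => rw [q.as_sum]
  rw [Finset.mul_sum, map_sum, Finset.mul_sum]
  refine Finset.sum_congr rfl fun u _ => ?_
  rw [monomial_mul, rieszLinear_monomial, mul_assoc]

theorem localizingMatrix_one (i : ℕ) (z : (Fin n →₀ ℕ) → ℝ) :
    localizingMatrix i 1 z = momentMatrix i z := by
  ext α β
  have h := rieszLinear_monomial_mul z (α.1 + β.1) 1 1
  rw [mul_one, rieszLinear_monomial, one_mul, one_mul] at h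
  exact h.symm

/-- The polynomial of degree at most `i` with coefficient vector `v`. -/
noncomputable def ofCoeffs {i : ℕ} (v : MultiIndex n i →₀ ℝ) : MvPolynomial (Fin n) ℝ :=
  v.sum fun α c => monomial α.1 c

/-- The quadratic form of the localizing matrix of `q` is `p ↦ L_z(p² q)`. -/
theorem rieszLinear_ofCoeffs (z : (Fin n →₀ ℕ) → ℝ) {i : ℕ} (v : MultiIndex n i →₀ ℝ)
    (q : MvPolynomial (Fin n) ℝ) : rieszLinear z (ofCoeffs v * ofCoeffs v * q) =
      v.sum fun α c => v.sum fun β d => star c * localizingMatrix i q z α β * d := by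
  simp only [ofCoeffs, Finsupp.sum, Finset.sum_mul, Finset.mul_sum, map_sum]
  rw [Finset.sum_comm]
  refine Finset.sum_congr rfl fun α _ => Finset.sum_congr rfl fun β _ => ?_
  rw [monomial_mul, rieszLinear_monomial_mul, star_trivial, localizingMatrix]
  ring

theorem exists_ofCoeffs_eq {i : ℕ} {p : MvPolynomial (Fin n) ℝ} (hp : p.totalDegree ≤ i) :
    ∃ v : MultiIndex n i →₀ ℝ, ofCoeffs v = p := by
  classical
  refine ⟨Finsupp.onFinset (p.support.subtype fun α => α.degree ≤ i) (fun α => p.coeff α.1)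
    fun α hα => by simpa using hα, ?_⟩
  rw [ofCoeffs, Finsupp.onFinset_sum _ (fun α => by simp)]
  conv_rhs => rw [p.as_sum]
  exact Finset.sum_subtype_of_mem (fun α => monomial α (p.coeff α))
    fun α hα => (le_totalDegree hα).trans hp

theorem nonneg_of_posSemidef {z : (Fin n →₀ ℕ) → ℝ} {i : ℕ} {q : MvPolynomial (Fin n) ℝ}
    (h : (localizingMatrix i q z).PosSemidef) {p : MvPolynomial (Fin n) ℝ}
    (hp : p.totalDegree ≤ i) : 0 ≤ rieszLinear z (p * p * q) := by
  obtain ⟨v, rfl⟩ := exists_ofCoeffs_eq hp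
  rw [rieszLinear_ofCoeffs]
  exact h.2 v

theorem posSemidef_of_nonneg {z : (Fin n →₀ ℕ) → ℝ} {q : MvPolynomial (Fin n) ℝ}
    (h : ∀ p : MvPolynomial (Fin n) ℝ, 0 ≤ rieszLinear z (p * p * q)) (i : ℕ) :
    (localizingMatrix i q z).PosSemidef := by
  refine ⟨?_, fun v => ?_⟩
  · ext α β
    simp [Matrix.conjTranspose_apply, localizingMatrix, add_comm β.1]
  · rw [← rieszLinear_ofCoeffs]
    exact h _

variable {f : MvPolynomial (Fin n) ℝ} {g : Fin m → MvPolynomial (Fin n) ℝ} {k : Fin n}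
  {φ : Measure ℝ}

theorem halfDegree_le_minOrder (g : Fin m → MvPolynomial (Fin n) ℝ) (j : Fin m) :
    halfDegree (g j) ≤ minOrder g :=
  Finset.le_sup (f := fun j => halfDegree (g j)) (Finset.mem_univ j)

theorem PrimalFeasible.mono {i i' : ℕ} (hi : i ≤ i') {z : (Fin n →₀ ℕ) → ℝ}
    (h : PrimalFeasible g k φ i' z) : PrimalFeasible g k φ i z where
  moment_psd := h.moment_psd.submatrix fun α : MultiIndex n i => ⟨α.1, α.2.trans hi⟩
  localizing_psd j := (h.localizing_psd j).submatrix
    fun α : MultiIndex n (i - halfDegree (g j)) => ⟨α.1, α.2.trans (Nat.sub_le_sub_right hi _)⟩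
  marginal l hl := h.marginal l (by lia)

theorem DualFeasible.mono {i i' : ℕ} (hi : i ≤ i') {p : Polynomial ℝ}
    {σ₀ : MvPolynomial (Fin n) ℝ} {σ : Fin m → MvPolynomial (Fin n) ℝ}
    (h : DualFeasible f g k i p σ₀ σ) : DualFeasible f g k i' p σ₀ σ where
  natDegree_le := h.natDegree_le.trans (by lia)
  isSumSq_zero := h.isSumSq_zero
  isSumSq := h.isSumSq
  totalDegree_zero_le := h.totalDegree_zero_le.trans (by lia)
  totalDegree_le j := (h.totalDegree_le j).trans (by lia)
  identity := h.identity

variable (f g k φ) in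
theorem monotone_primalValue : Monotone (primalValue f g k φ) := fun _ _ hi =>
  le_iInf₂ fun z hz => iInf₂_le z (hz.mono hi)

variable (f g k φ) in
theorem monotone_dualValue : Monotone (dualValue f g k φ) := fun _ _ hi =>
  iSup_le fun p => iSup_le fun σ₀ => iSup_le fun σ => iSup_le fun h =>
    le_iSup_of_le p <| le_iSup_of_le σ₀ <| le_iSup_of_le σ <| le_iSup_of_le (h.mono hi) le_rfl

theorem DualFeasible.integral_le_dualValue {i : ℕ} {p : Polynomial ℝ}
    {σ₀ : MvPolynomial (Fin n) ℝ} {σ : Fin m → MvPolynomial (Fin n) ℝ}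
    (h : DualFeasible f g k i p σ₀ σ) :
    ((∫ y, p.eval y ∂φ : ℝ) : EReal) ≤ dualValue f g k φ i :=
  le_iSup_of_le p <| le_iSup_of_le σ₀ <| le_iSup_of_le σ <| le_iSup_of_le h le_rfl

theorem integral_eval_eq_sum_moment (hφ : ∀ l : ℕ, Integrable (fun y : ℝ => y ^ l) φ)
    (p : Polynomial ℝ) :
    ∫ y, p.eval y ∂φ = ∑ l ∈ Finset.range (p.natDegree + 1), p.coeff l * moment φ l := by
  simp only [Polynomial.eval_eq_sum_range, moment]
  rw [integral_finsetSum _ fun l _ => (hφ l).const_mul _]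
  simp only [integral_const_mul]

/-- Weak duality. -/
theorem dualValue_le_primalValue (hφ : ∀ l : ℕ, Integrable (fun y : ℝ => y ^ l) φ) {i : ℕ}
    (hi : minOrder g ≤ i) : dualValue f g k φ i ≤ primalValue f g k φ i := by
  refine iSup_le fun p => iSup_le fun σ₀ => iSup_le fun σ => iSup_le fun h =>
    le_iInf₂ fun z hz => EReal.coe_le_coe_iff.2 ?_
  have hp : rieszLinear z (Polynomial.aeval (X k) p) = ∫ y, p.eval y ∂φ := by
    rw [integral_eval_eq_sum_moment hφ, Polynomial.aeval_eq_sum_range, map_sum]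
    refine Finset.sum_congr rfl fun l hl => ?_
    rw [map_smul, rieszLinear_apply, hz.marginal l ?_, smul_eq_mul]
    have := h.natDegree_le
    have := Finset.mem_range.1 hl
    lia
  have h0 : 0 ≤ rieszLinear z σ₀ := by
    refine nonneg_of_isSumSq (d := i) (fun q hq => ?_) h.isSumSq_zero
      (h.totalDegree_zero_le.trans (by lia))
    have hpsd := hz.moment_psd
    rw [← localizingMatrix_one] at hpsd
    simpa using nonneg_of_posSemidef hpsd hq
  have hj : ∀ j, 0 ≤ rieszLinear z (σ j * g j) := by
    intro j
    rcases eq_or_ne (σ j) 0 with hσ | hσ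
    · simp [hσ]
    rcases eq_or_ne (g j) 0 with hg | hg
    · simp [hg]
    have hdeg := h.totalDegree_le j
    rw [totalDegree_mul_of_isDomain hσ hg] at hdeg
    have hv := (halfDegree_le_minOrder g j).trans hi
    refine nonneg_of_isSumSq (L := rieszLinear z ∘ₗ LinearMap.mulRight ℝ (g j))
      (d := i - halfDegree (g j)) (fun q hq => ?_) (h.isSumSq j) ?_
    · exact nonneg_of_posSemidef (hz.localizing_psd j) hq
    · rw [halfDegree] at hv ⊢
      lia
  have e := congrArg (rieszLinear z) h.identity
  rw [map_sub, map_add, map_sum, hp, rieszLinear_apply z f] at e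
  have := Finset.sum_nonneg fun j (_ : j ∈ Finset.univ) => hj j
  linarith

end Duality

/-! ### A primal feasible solution with value `∫ J` -/

section Extension

/-- Real functions that are bounded on `[a, b]`. -/
def boundedFunctions (a b : ℝ) : Submodule ℝ (ℝ → ℝ) where
  carrier := {h | ∃ B : ℝ, ∀ y ∈ Set.Icc a b, |h y| ≤ B}
  zero_mem' := ⟨0, by simp⟩
  add_mem' := by
    rintro h h' ⟨B, hB⟩ ⟨B', hB'⟩
    exact ⟨B + B', fun y hy => (abs_add_le _ _).trans (add_le_add (hB y hy) (hB' y hy))⟩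
  smul_mem' := by
    rintro c h ⟨B, hB⟩
    refine ⟨|c| * B, fun y hy => ?_⟩
    rw [Pi.smul_apply, smul_eq_mul, abs_mul]
    exact mul_le_mul_of_nonneg_left (hB y hy) (abs_nonneg c)

/-- The integral with respect to the uniform measure extends to a positive linear functional on all
functions that are bounded on `[a, b]`, measurable or not. -/
theorem exists_positive_extension {a b : ℝ} (hab : a < b) :
    ∃ L : boundedFunctions a b →ₗ[ℝ] ℝ,
      (∀ h : boundedFunctions a b, Measurable h.1 → L h = ∫ y, h.1 y ∂uniform a b) ∧
      ∀ h : boundedFunctions a b, (∀ y ∈ Set.Icc a b, 0 ≤ h.1 y) → 0 ≤ L h := by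
  let D : Submodule ℝ (boundedFunctions a b) :=
    { carrier := {h | Measurable h.1}
      zero_mem' := measurable_const
      add_mem' := fun h h' => h.add h'
      smul_mem' := fun c _ h => h.const_smul c }
  have hint : ∀ h : D, Integrable h.1.1 (uniform a b) := by
    rintro ⟨⟨h, B, hB⟩, hm⟩
    exact integrable_uniform_of_bounded hab hm hB
  let I : boundedFunctions a b →ₗ.[ℝ] ℝ :=
    { domain := D
      toFun :=
        { toFun := fun h => ∫ y, h.1.1 y ∂uniform a b
          map_add' := fun h h' => integral_add (hint h) (hint h')
          map_smul' := fun c h => integral_const_mul c _ } }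
  let S : PointedCone ℝ (boundedFunctions a b) :=
    { carrier := {h | ∀ y ∈ Set.Icc a b, 0 ≤ h.1 y}
      zero_mem' := fun y _ => le_rfl
      add_mem' := fun h h' y hy => add_nonneg (h y hy) (h' y hy)
      smul_mem' := fun c _ h y hy => mul_nonneg c.2 (h y hy) }
  obtain ⟨L, hL, hpos⟩ := riesz_extension S I
    (fun h hh => by
      refine integral_nonneg_of_ae ?_
      filter_upwards [ae_mem_Icc_uniform a b] with y hy using hh y hy)
    (fun h => by
      obtain ⟨B, hB⟩ := h.2
      refine ⟨⟨⟨fun _ => B, |B|, fun _ _ => le_rfl⟩, measurable_const⟩, fun y hy => ?_⟩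
      have := neg_le_of_abs_le (hB y hy)
      change 0 ≤ B + h.1 y
      linarith)
  exact ⟨L, fun h hm => hL ⟨h, hm⟩, hpos⟩

variable {n m : ℕ}

/-- A sequence that is feasible for the primal relaxations of all orders, with value `∫ J`: the
moments of a minimizing selection `y ↦ x(y)`. A positive extension of the integral to nonmeasurable
functions gives sense to these moments for an arbitrary selection. -/
theorem exists_primalFeasible {g : Fin m → MvPolynomial (Fin n) ℝ} {k : Fin n} {a b : ℝ}
    (hg : Archimedean g) (f : MvPolynomial (Fin n) ℝ) (hab : a < b)
    (hY : projection g k = Set.Icc a b) :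
    ∃ z : (Fin n →₀ ℕ) → ℝ, (∀ i, PrimalFeasible g k (uniform a b) i z) ∧
      riesz z f = ∫ y, optValue f g k y ∂uniform a b := by
  classical
  obtain ⟨L, hL, hpos⟩ := exists_positive_extension hab
  choose x hx using fun y : Set.Icc a b => (isLeast_optValue hg f hY y.2).1
  let ξ : ℝ → Fin n → ℝ := fun y => if hy : y ∈ Set.Icc a b then x ⟨y, hy⟩ else 0
  have hξ : ∀ y ∈ Set.Icc a b, ξ y ∈ feasibleSet g ∧ ξ y k = y ∧
      eval (ξ y) f = optValue f g k y := by
    intro y hy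
    simp only [ξ, hy, dif_pos]
    exact ⟨(hx ⟨y, hy⟩).1.1, (hx ⟨y, hy⟩).1.2, (hx ⟨y, hy⟩).2⟩
  let Φ : MvPolynomial (Fin n) ℝ →ₗ[ℝ] boundedFunctions a b :=
    { toFun := fun q => ⟨fun y => eval (ξ y) q, by
        obtain ⟨B, -, hB⟩ := exists_bound hg q
        exact ⟨B, fun y hy => hB _ (hξ y hy).1⟩⟩
      map_add' := fun p q => by ext y; simp
      map_smul' := fun c q => by ext y; simp [smul_eval] }
  -- `L` only depends on the values on `[a, b]`
  have hcongr : ∀ h h' : boundedFunctions a b, (∀ y ∈ Set.Icc a b, h.1 y = h'.1 y) →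
      L h = L h' := by
    intro h h' e
    refine le_antisymm ?_ ?_ <;> rw [← sub_nonneg, ← map_sub] <;> refine hpos _ fun y hy => ?_
    · change 0 ≤ h'.1 y - h.1 y
      rw [e y hy, sub_self]
    · change 0 ≤ h.1 y - h'.1 y
      rw [e y hy, sub_self]
  set z : (Fin n →₀ ℕ) → ℝ := fun α => L (Φ (monomial α 1)) with hz
  have hzL : rieszLinear z = L ∘ₗ Φ := by
    refine (basisMonomials (Fin n) ℝ).ext fun α => ?_
    rw [rieszLinear, Module.Basis.constr_basis]
    simp [hz]
  have hr : ∀ q, rieszLinear z q = L (Φ q) := fun q => by rw [hzL]; rfl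
  have hloc : ∀ q : MvPolynomial (Fin n) ℝ, (∀ x ∈ feasibleSet g, 0 ≤ eval x q) →
      ∀ i, (localizingMatrix i q z).PosSemidef := by
    refine fun q hq => posSemidef_of_nonneg fun p => ?_
    rw [hr]
    refine hpos _ fun y hy => ?_
    change 0 ≤ eval (ξ y) (p * p * q)
    rw [map_mul, map_mul]
    exact mul_nonneg (mul_self_nonneg _) (hq _ (hξ y hy).1)
  refine ⟨z, fun i => ⟨?_, fun j => ?_, fun l _ => ?_⟩, ?_⟩
  · rw [← localizingMatrix_one]
    exact hloc 1 (fun x _ => by simp) i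
  · exact hloc (g j) (fun x hx => hx j) _
  · have hb : (fun y : ℝ => y ^ l) ∈ boundedFunctions a b := by
      obtain ⟨B, hB⟩ := (isCompact_Icc (a := a) (b := b)).exists_bound_of_continuousOn
        (continuous_pow l).continuousOn
      exact ⟨B, hB⟩
    rw [← rieszLinear_apply, hr, hcongr _ ⟨_, hb⟩ fun y hy => ?_,
      hL _ (measurable_id.pow_const l), moment]
    change eval (ξ y) (X k ^ l) = y ^ l
    rw [map_pow, eval_X, (hξ y hy).2.1]
  · have hb : optValue f g k ∈ boundedFunctions a b := by
      obtain ⟨B, -, hB⟩ := exists_bound hg f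
      exact ⟨B, fun y hy => abs_optValue_le hg hY hB hy⟩
    rw [← rieszLinear_apply, hr, hcongr _ ⟨_, hb⟩ fun y hy => (hξ y hy).2.2,
      hL _ (measurable_optValue hg f hY)]

end Extension

/-! ### Convergence of the relaxations and of nearly optimal dual solutions -/

section Convergence

variable {n m : ℕ} {f : MvPolynomial (Fin n) ℝ} {g : Fin m → MvPolynomial (Fin n) ℝ} {k : Fin n}
  {a b : ℝ}

theorem eval_aeval_X (x : Fin n → ℝ) (p : Polynomial ℝ) :
    eval x (Polynomial.aeval (X k) p) = p.eval (x k) := by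
  have h : (eval x).comp (algebraMap ℝ (MvPolynomial (Fin n) ℝ)) = RingHom.id ℝ := by ext; simp
  rw [Polynomial.aeval_def, Polynomial.hom_eval₂, h, eval_X, Polynomial.eval₂_id]

theorem DualFeasible.eval_le_optValue (hg : Archimedean g) (hY : projection g k = Set.Icc a b)
    {i : ℕ} {p : Polynomial ℝ} {σ₀ : MvPolynomial (Fin n) ℝ} {σ : Fin m → MvPolynomial (Fin n) ℝ}
    (h : DualFeasible f g k i p σ₀ σ) {y : ℝ} (hy : y ∈ Set.Icc a b) :
    p.eval y ≤ optValue f g k y := by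
  refine le_optValue hg hY hy fun x hx hxy => ?_
  have h0 := eval_nonneg_of_mem_feasibleSet hx h.isSumSq_zero h.isSumSq
  rw [← h.identity, map_sub, eval_aeval_X, hxy] at h0
  linarith

theorem primalValue_le_integral (hg : Archimedean g) (f : MvPolynomial (Fin n) ℝ) (hab : a < b)
    (hY : projection g k = Set.Icc a b) (i : ℕ) : primalValue f g k (uniform a b) i ≤
      ((∫ y, optValue f g k y ∂uniform a b : ℝ) : EReal) := by
  obtain ⟨z, hz, e⟩ := exists_primalFeasible hg f hab hY
  exact e ▸ iInf₂_le z (hz i)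

theorem dualValue_le_integral (hg : Archimedean g) (f : MvPolynomial (Fin n) ℝ) (hab : a < b)
    (hY : projection g k = Set.Icc a b) (i : ℕ) : dualValue f g k (uniform a b) i ≤
      ((∫ y, optValue f g k y ∂uniform a b : ℝ) : EReal) := by
  refine iSup_le fun p => iSup_le fun σ₀ => iSup_le fun σ => iSup_le fun h =>
    EReal.coe_le_coe_iff.2 (integral_mono_ae
      (integrable_uniform_of_continuous hab p.continuous) (integrable_optValue hg f hab hY) ?_)
  filter_upwards [ae_mem_Icc_uniform a b] with y hy using h.eval_le_optValue hg hY hy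

/-- By Putinar's Positivstellensatz, a polynomial that is strictly below the optimal value function
is feasible for the dual relaxations of all sufficiently large orders. -/
theorem exists_dualFeasible (hg : Archimedean g) (hY : projection g k = Set.Icc a b)
    {p : Polynomial ℝ} (hp : ∀ y ∈ Set.Icc a b, p.eval y < optValue f g k y) :
    ∃ (i : ℕ) (σ₀ : MvPolynomial (Fin n) ℝ) (σ : Fin m → MvPolynomial (Fin n) ℝ),
      DualFeasible f g k i p σ₀ σ := by
  obtain ⟨σ₀, σ, h₀, hσ, e⟩ := hg.mem_quadraticModule_of_pos
    (f := f - Polynomial.aeval (X k) p) fun x hx => by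
      rw [map_sub, eval_aeval_X, sub_pos]
      exact (hp _ (mem_Icc_of_mem_feasibleSet hY hx)).trans_le (optValue_le hg hY hx)
  have hj : ∀ j, (σ j * g j).totalDegree ≤ ∑ j, (σ j * g j).totalDegree := fun j =>
    Finset.single_le_sum (f := fun j => (σ j * g j).totalDegree) (fun _ _ => Nat.zero_le _)
      (Finset.mem_univ j)
  refine ⟨p.natDegree + σ₀.totalDegree + ∑ j, (σ j * g j).totalDegree, σ₀, σ,
    ⟨by lia, h₀, hσ, by lia, fun j => ?_, e⟩⟩
  have := hj j
  lia

theorem tendsto_dualValue (hg : Archimedean g) (f : MvPolynomial (Fin n) ℝ) (hab : a < b)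
    (hY : projection g k = Set.Icc a b) : Tendsto (dualValue f g k (uniform a b)) atTop
      (𝓝 ((∫ y, optValue f g k y ∂uniform a b : ℝ) : EReal)) := by
  refine tendsto_order.2 ⟨fun c hc => ?_, fun c hc => Eventually.of_forall fun i =>
    (dualValue_le_integral hg f hab hY i).trans_lt hc⟩
  obtain ⟨r, hcr, hr⟩ := EReal.lt_iff_exists_real_btwn.1 hc
  obtain ⟨p, hp, hrp⟩ := exists_polynomial_lt_optValue hg f hab hY (EReal.coe_lt_coe_iff.1 hr)
  obtain ⟨i, σ₀, σ, h⟩ := exists_dualFeasible hg hY hp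
  filter_upwards [eventually_ge_atTop i] with i' hi'
  exact hcr.trans ((EReal.coe_lt_coe_iff.2 hrp).trans_le (h.mono hi').integral_le_dualValue)

theorem tendsto_primalValue (hg : Archimedean g) (f : MvPolynomial (Fin n) ℝ) (hab : a < b)
    (hY : projection g k = Set.Icc a b) : Tendsto (primalValue f g k (uniform a b)) atTop
      (𝓝 ((∫ y, optValue f g k y ∂uniform a b : ℝ) : EReal)) := by
  refine tendsto_of_tendsto_of_tendsto_of_le_of_le' (tendsto_dualValue hg f hab hY)
    tendsto_const_nhds ?_ (Eventually.of_forall (primalValue_le_integral hg f hab hY))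
  filter_upwards [eventually_ge_atTop (minOrder g)] with i hi
  exact dualValue_le_primalValue
    (fun l => integrable_uniform_of_continuous hab (continuous_pow l)) hi

theorem tendsto_integral_of_nearly_optimal (hg : Archimedean g) (hab : a < b)
    (hY : projection g k = Set.Icc a b) {i₀ : ℕ} {ε : ℕ → ℝ} (hε : Tendsto ε atTop (𝓝 0))
    {p : ℕ → Polynomial ℝ}
    (hle : ∀ i ≥ i₀, ∀ y ∈ Set.Icc a b, (p i).eval y ≤ optValue f g k y)
    (hopt : ∀ i ≥ i₀, dualValue f g k (uniform a b) i - (ε i : EReal) ≤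
      ((∫ y, (p i).eval y ∂uniform a b : ℝ) : EReal)) :
    Tendsto (fun i => ∫ y, (p i).eval y ∂uniform a b) atTop
      (𝓝 (∫ y, optValue f g k y ∂uniform a b)) := by
  have hupper : ∀ i ≥ i₀, ∫ y, (p i).eval y ∂uniform a b ≤ ∫ y, optValue f g k y ∂uniform a b := by
    intro i hi
    refine integral_mono_ae (integrable_uniform_of_continuous hab (p i).continuous)
      (integrable_optValue hg f hab hY) ?_
    filter_upwards [ae_mem_Icc_uniform a b] with y hy using hle i hi y hy
  refine tendsto_order.2 ⟨fun c hc => ?_, fun c hc => ?_⟩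
  · obtain ⟨c', hcc', hc'⟩ := exists_between hc
    filter_upwards [(tendsto_dualValue hg f hab hY).eventually_const_lt
      (EReal.coe_lt_coe_iff.2 hc'), hε.eventually_lt_const (sub_pos.2 hcc'),
      eventually_ge_atTop i₀] with i h₁ h₂ h₃
    have h := (EReal.sub_le_sub h₁.le le_rfl).trans (hopt i h₃)
    rw [← EReal.coe_sub, EReal.coe_le_coe_iff] at h
    linarith
  · filter_upwards [eventually_ge_atTop i₀] with i hi using (hupper i hi).trans_lt hc

theorem continuous_partialSups_eval (p : ℕ → Polynomial ℝ) (j : ℕ) :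
    Continuous fun y => partialSups (fun l => (p l).eval y) j := by
  induction j with
  | zero => simpa using (p 0).continuous
  | succ j ih =>
    simp only [← Order.succ_eq_add_one, partialSups_succ]
    exact ih.sup (p _).continuous

/-- The running maxima of polynomials below `J` whose integrals converge to that of `J` converge to
`J` almost everywhere: they are monotone in the order, and their integrals are squeezed. -/
theorem ae_tendsto_partialSups (hg : Archimedean g) (hab : a < b)
    (hY : projection g k = Set.Icc a b) {p : ℕ → Polynomial ℝ}
    (hle : ∀ i, ∀ y ∈ Set.Icc a b, (p i).eval y ≤ optValue f g k y)
    (hlim : Tendsto (fun i => ∫ y, (p i).eval y ∂uniform a b) atTop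
      (𝓝 (∫ y, optValue f g k y ∂uniform a b))) :
    ∀ᵐ y ∂uniform a b, Tendsto (fun j : ℕ => partialSups (fun l => (p l).eval y) j) atTop
      (𝓝 (optValue f g k y)) := by
  have hsup : ∀ j, ∀ y ∈ Set.Icc a b, partialSups (fun l => (p l).eval y) j ≤ optValue f g k y :=
    fun j y hy => partialSups_le _ _ _ fun i _ => hle i y hy
  have hint : ∀ j, Integrable (fun y => partialSups (fun l => (p l).eval y) j) (uniform a b) :=
    fun j => integrable_uniform_of_continuous hab (continuous_partialSups_eval p j)
  refine tendsto_of_integral_tendsto_of_monotone hint (integrable_optValue hg f hab hY) ?_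
    (Eventually.of_forall fun y => (partialSups fun l => (p l).eval y).monotone) ?_
  · refine tendsto_of_tendsto_of_tendsto_of_le_of_le hlim tendsto_const_nhds (fun j => ?_)
      fun j => ?_
    · exact integral_mono (integrable_uniform_of_continuous hab (p j).continuous) (hint j)
        fun y => le_partialSups (fun l => (p l).eval y) j
    · refine integral_mono_ae (hint j) (integrable_optValue hg f hab hY) ?_
      filter_upwards [ae_mem_Icc_uniform a b] with y hy using hsup j y hy
  · filter_upwards [ae_mem_Icc_uniform a b] with y hy j using hsup j y hy

end Convergence

end JointMarginal

theorem mainTheorem1 {n m : ℕ} (f : MvPolynomial (Fin n) ℝ)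
    (g : Fin m → MvPolynomial (Fin n) ℝ) (k : Fin n)
    (hArch : JointMarginal.Archimedean g)
    (a b : ℝ) (hab : a < b) (hY : JointMarginal.projection g k = Set.Icc a b) :
    -- the optimal value function is a minimum, and it is integrable
    (∀ y ∈ Set.Icc a b,
      IsLeast ((fun x : Fin n → ℝ => MvPolynomial.eval x f) '' JointMarginal.fiber g k y)
        (JointMarginal.optValue f g k y)) ∧
    MeasureTheory.Integrable (JointMarginal.optValue f g k) (JointMarginal.uniform a b) ∧
    -- (a) for the primal and for the dual values
    (MonotoneOn (JointMarginal.primalValue f g k (JointMarginal.uniform a b))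
        (Set.Ici (JointMarginal.minOrder g)) ∧
      Filter.Tendsto (JointMarginal.primalValue f g k (JointMarginal.uniform a b)) Filter.atTop
        (nhds ((∫ y, JointMarginal.optValue f g k y ∂(JointMarginal.uniform a b) : ℝ) : EReal))) ∧
    (MonotoneOn (JointMarginal.dualValue f g k (JointMarginal.uniform a b))
        (Set.Ici (JointMarginal.minOrder g)) ∧
      Filter.Tendsto (JointMarginal.dualValue f g k (JointMarginal.uniform a b)) Filter.atTop
        (nhds ((∫ y, JointMarginal.optValue f g k y ∂(JointMarginal.uniform a b) : ℝ) : EReal))) ∧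
    -- (b) for all nearly optimal dual solutions, from some order `i₀` on
    (∀ (i₀ : ℕ), JointMarginal.minOrder g ≤ i₀ →
      ∀ (ε : ℕ → ℝ), Filter.Tendsto ε Filter.atTop (nhds 0) →
      ∀ (p : ℕ → Polynomial ℝ) (σ₀ : ℕ → MvPolynomial (Fin n) ℝ)
        (σ : ℕ → Fin m → MvPolynomial (Fin n) ℝ),
      (∀ i ≥ i₀, JointMarginal.DualFeasible f g k i (p i) (σ₀ i) (σ i)) →
      (∀ i ≥ i₀, JointMarginal.dualValue f g k (JointMarginal.uniform a b) i - (ε i : EReal) ≤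
        ((∫ y, (p i).eval y ∂(JointMarginal.uniform a b) : ℝ) : EReal)) →
      (∀ i ≥ i₀, ∀ y ∈ Set.Icc a b, (p i).eval y ≤ JointMarginal.optValue f g k y) ∧
      Filter.Tendsto
        (fun i => ∫ y, |JointMarginal.optValue f g k y - (p i).eval y|
          ∂(JointMarginal.uniform a b))
        Filter.atTop (nhds 0) ∧
      (∀ᵐ y ∂(JointMarginal.uniform a b),
        Monotone (fun j : ℕ => partialSups (fun l => (p (i₀ + l)).eval y) j) ∧
        Filter.Tendsto (fun j : ℕ => partialSups (fun l => (p (i₀ + l)).eval y) j)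
          Filter.atTop (nhds (JointMarginal.optValue f g k y))) ∧
      JointMarginal.TendstoAlmostUniformlyOn (JointMarginal.uniform a b) (Set.Icc a b)
        (fun j y => partialSups (fun l => (p (i₀ + l)).eval y) j)
        (JointMarginal.optValue f g k)) := by
  have hJ := JointMarginal.integrable_optValue hArch f hab hY
  refine ⟨fun y hy => JointMarginal.isLeast_optValue hArch f hY hy, hJ,
    ⟨(JointMarginal.monotone_primalValue f g k _).monotoneOn _,
      JointMarginal.tendsto_primalValue hArch f hab hY⟩,
    ⟨(JointMarginal.monotone_dualValue f g k _).monotoneOn _,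
      JointMarginal.tendsto_dualValue hArch f hab hY⟩, ?_⟩
  intro i₀ _ ε hε p σ₀ σ hfeas hopt
  have hle : ∀ i ≥ i₀, ∀ y ∈ Set.Icc a b, (p i).eval y ≤ JointMarginal.optValue f g k y :=
    fun i hi y hy => (hfeas i hi).eval_le_optValue hArch hY hy
  have hlim := JointMarginal.tendsto_integral_of_nearly_optimal hArch hab hY hε hle hopt
  have hae := JointMarginal.ae_tendsto_partialSups hArch hab hY (p := fun l => p (i₀ + l))
    (fun l => hle _ (Nat.le_add_right _ _))
    (hlim.comp (Filter.tendsto_atTop_mono (fun l => Nat.le_add_left l i₀) Filter.tendsto_id))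
  refine ⟨hle, ?_, ?_, ?_⟩
  · have h0 := hlim.const_sub (∫ y, JointMarginal.optValue f g k y ∂(JointMarginal.uniform a b))
    rw [sub_self] at h0
    refine h0.congr' ?_
    filter_upwards [Filter.eventually_ge_atTop i₀] with i hi
    rw [← MeasureTheory.integral_sub hJ
      (JointMarginal.integrable_uniform_of_continuous hab (p i).continuous)]
    refine MeasureTheory.integral_congr_ae ?_
    filter_upwards [JointMarginal.ae_mem_Icc_uniform a b] with y hy
    exact (abs_of_nonneg (sub_nonneg.2 (hle i hi y hy))).symm
  · filter_upwards [hae] with y hy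
    exact ⟨(partialSups fun l => (p (i₀ + l)).eval y).monotone, hy⟩
  · intro δ hδ
    have := JointMarginal.isProbabilityMeasure_uniform hab
    obtain ⟨t, hts, htm, hμ, ht⟩ := MeasureTheory.tendstoUniformlyOn_of_ae_tendsto
      (fun j => (JointMarginal.continuous_partialSups_eval
        (fun l => p (i₀ + l)) j).stronglyMeasurable)
      (JointMarginal.measurable_optValue hArch f hY).stronglyMeasurable
      measurableSet_Icc (MeasureTheory.measure_ne_top (JointMarginal.uniform a b) _)
      (hae.mono fun y hy _ => hy) (half_pos hδ)
    exact ⟨t, hts, htm, hμ.trans_lt ((ENNReal.ofReal_lt_ofReal_iff hδ).2 (half_lt_self hδ)), ht⟩
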